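/- Let $n\ge 1$ and let $0=X_0,X_1,\dots,X_n$ be an $n$-step two-dimensional equilateral isotropic random walk, that is, the steps $X_1-X_0,\dots,X_n-X_{n-1}$ are independent random vectors in $\mathbb R^2$, each uniformly distributed on the unit circle. Let $K_n$ be its number of self-intersections, that is, the number of pairs $(k,l)$ with $1\le k<l\le n$ and $l-k\ge 2$ such that the segments $[X_{k-1},X_k]$ and $[X_{l-1},X_l]$ intersect at a point that is interior to each of them. Then $$\mathrm{Ex}[K_n]=\frac{2}{\pi^2}\,n\log n+O(n),$$ that is, there is an absolute constant $C$ such that $\left|\mathrm{Ex}[K_n]-\frac{2}{\pi^2}\,n\log n\right|\le C\,n$ for all $n\ge 1$. -/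

import Mathlib

open MeasureTheory ProbabilityTheory

noncomputable section

/-- The Euclidean plane. -/
abbrev Plane : Type := EuclideanSpace ℝ (Fin 2)

/-- The uniform probability distribution on the unit circle of the plane: the law of
`(cos θ, sin θ)` for an angle `θ` that is uniformly distributed on `[0, 2π)`. -/
def uniformUnitCircle : Measure Plane :=
  (ProbabilityTheory.cond (volume : Measure ℝ) (Set.Ico 0 (2 * Real.pi))).map
    (fun θ : ℝ => (!₂[Real.cos θ, Real.sin θ] : Plane))

/-- The points `X 0, …, X n` form an `n`-step equilateral isotropic random walk in the plane:
the walk starts at the origin, and its `n` steps are independent, each of them being uniformly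
distributed on the unit circle. -/
structure IsEquilateralIsotropicWalk {Ω : Type*} [MeasurableSpace Ω] {n : ℕ}
    (X : Fin (n + 1) → Ω → Plane) (P : Measure Ω) : Prop where
  start_zero : ∀ ω, X 0 ω = 0
  indep_steps : iIndepFun (fun (k : Fin n) (ω : Ω) => X k.succ ω - X k.castSucc ω) P
  law_step : ∀ k : Fin n, HasLaw (fun ω => X k.succ ω - X k.castSucc ω) uniformUnitCircle P

/-- The number of self-intersections of the polygonal path through `x 0, …, x n`: the number of
pairs of segments, with indices `k`, `l` such that `l - k ≥ 2`, that meet at an interior point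
of each of them. (The segment with index `k : Fin n` joins `x k` to `x (k + 1)`.) -/
def selfIntersections {n : ℕ} (x : Fin (n + 1) → Plane) : ℕ :=
  Set.ncard {p : Fin n × Fin n | (p.1 : ℕ) + 2 ≤ (p.2 : ℕ) ∧
    (openSegment ℝ (x p.1.castSucc) (x p.1.succ) ∩
      openSegment ℝ (x p.2.castSucc) (x p.2.succ)).Nonempty}

end

/-! Take two segments with directions u and v, separated by j ≥ 1 intermediate steps with sum S. Off
the null event that u and v are parallel, they cross exactly when S lies in the open parallelogram
`crossingSet u v` = {-su - tv : 0 < s, t < 1}, of area |det(u, v)|. Since S is independent of (u, v)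
and each step has covariance I/2, S behaves near the origin as if it had density 1/(πj). The
crossing probability given (u, v) is thus about |det(u, v)|/(πj); the mean of |det(u, v)| is 2/π, so
the unconditional probability is about 2/(π²j). Summing 1/j over all pairs gives n log n + O(n), and
a summable error in j contributes only O(n).

The analytic core is the local limit estimate `exists_summable_abs_measureReal_sub_le`, with an
error uniform over the parallelograms. The characteristic function of S is J₀(|t|)^j.
`measureReal_eq_integral_charFun_mul_fourier` turns the mass of a set into an integral of this power
against the transform of the indicator. Near 0 the power is compared with a Gaussian; elsewhere |J₀|
≤ ρ < 1 gives geometric decay in j, and twelve of the factors secure integrability. The geometry is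
in `openSegment_inter_nonempty_iff` and `volume_crossingSet`;
`abs_measureReal_sum_mem_crossingSet_sub_le` joins the two sides. -/

/-! ### Bounds for the Bessel function J₀ -/

/-- The Bessel function of order zero, in its integral representation. -/
noncomputable def besselZero (r : ℝ) : ℝ :=
  (2 * Real.pi)⁻¹ * ∫ θ in (0 : ℝ)..(2 * Real.pi), Real.cos (r * Real.cos θ)

theorem besselZero_intervalIntegrable (r a b : ℝ) :
    IntervalIntegrable (fun θ => Real.cos (r * Real.cos θ)) volume a b :=
  Continuous.intervalIntegrable (by fun_prop) a b

/-- The variance of cos(r cos θ) is nonnegative, and the double-angle formula evaluates its second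
moment. This carries a bound below 1 from 2r down to r. -/
theorem besselZero_sq_le (r : ℝ) : besselZero r ^ 2 ≤ (1 + besselZero (2 * r)) / 2 := by
  have hpi := Real.pi_pos
  set m := besselZero r with hm
  have h1 : ∫ θ in (0 : ℝ)..(2 * Real.pi), Real.cos (r * Real.cos θ) = 2 * Real.pi * m := by
    rw [hm, besselZero]; field_simp
  have h2 : ∫ θ in (0 : ℝ)..(2 * Real.pi), Real.cos (2 * r * Real.cos θ)
      = 2 * Real.pi * besselZero (2 * r) := by
    rw [besselZero]; field_simp
  have h3 : 0 ≤ ∫ θ in (0 : ℝ)..(2 * Real.pi), (Real.cos (r * Real.cos θ) - m) ^ 2 :=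
    intervalIntegral.integral_nonneg (by positivity) (fun _ _ => sq_nonneg _)
  have h4 : ∀ θ, (Real.cos (r * Real.cos θ) - m) ^ 2 =
      (1 / 2) * Real.cos (2 * r * Real.cos θ) - 2 * m * Real.cos (r * Real.cos θ)
        + (1 / 2 + m ^ 2) := by
    intro θ
    rw [mul_assoc 2 r, Real.cos_two_mul]; ring
  simp_rw [h4] at h3
  rw [intervalIntegral.integral_add, intervalIntegral.integral_sub,
    intervalIntegral.integral_const_mul, intervalIntegral.integral_const_mul, h1, h2,
    intervalIntegral.integral_const, smul_eq_mul] at h3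
  · have : 0 ≤ 2 * Real.pi * ((1 + besselZero (2 * r)) / 2 - m ^ 2) := by linarith
    have := nonneg_of_mul_nonneg_right this (by positivity)
    linarith
  all_goals exact Continuous.intervalIntegrable (by fun_prop) _ _

theorem abs_besselZero_sub_le {r : ℝ} (hr0 : 0 ≤ r) (hr1 : r ≤ 1) :
    |besselZero r - (1 - r ^ 2 / 4)| ≤ 5 / 96 * r ^ 4 := by
  have hpi := Real.pi_pos
  have hb : ∀ θ, |Real.cos (r * Real.cos θ) - (1 - (r * Real.cos θ) ^ 2 / 2)|
      ≤ 5 / 96 * r ^ 4 := by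
    intro θ
    have hc : |r * Real.cos θ| ≤ r := by
      rw [abs_mul, abs_of_nonneg hr0]
      exact mul_le_of_le_one_right hr0 (Real.abs_cos_le_one θ)
    refine (Real.cos_bound (hc.trans hr1)).trans ?_
    have := pow_le_pow_left₀ (abs_nonneg _) hc 4
    linarith
  have h := intervalIntegral.norm_integral_le_of_norm_le_const (a := 0) (b := 2 * Real.pi)
    (f := fun θ => Real.cos (r * Real.cos θ) - (1 - (r * Real.cos θ) ^ 2 / 2))
    (C := 5 / 96 * r ^ 4) (fun θ _ => hb θ)
  have h2 : ∫ θ in (0 : ℝ)..(2 * Real.pi),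
      (Real.cos (r * Real.cos θ) - (1 - (r * Real.cos θ) ^ 2 / 2)) =
      2 * Real.pi * (besselZero r - (1 - r ^ 2 / 4)) := by
    have h4 : ∀ θ, Real.cos (r * Real.cos θ) - (1 - (r * Real.cos θ) ^ 2 / 2) =
        Real.cos (r * Real.cos θ) - 1 + r ^ 2 / 2 * Real.cos θ ^ 2 := by intro θ; ring
    simp_rw [h4]
    rw [intervalIntegral.integral_add, intervalIntegral.integral_sub,
      intervalIntegral.integral_const_mul, integral_cos_sq, besselZero,
      intervalIntegral.integral_const, smul_eq_mul]
    · simp; field_simp; ring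
    all_goals exact Continuous.intervalIntegrable (by fun_prop) _ _
  rw [h2, Real.norm_eq_abs, abs_mul, sub_zero, abs_of_pos (by positivity : 0 < 2 * Real.pi),
    mul_comm _ (2 * Real.pi)] at h
  exact le_of_mul_le_mul_left h (by positivity)

theorem besselZero_nonneg {r : ℝ} (hr0 : 0 ≤ r) (hr1 : r ≤ 1) : 0 ≤ besselZero r := by
  have h := (abs_le.mp (abs_besselZero_sub_le hr0 hr1)).1
  have h2 : r ^ 2 ≤ 1 := pow_le_one₀ hr0 hr1
  have h4 : r ^ 4 ≤ 1 := pow_le_one₀ hr0 hr1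
  linarith

/-- Half of the quadratic term -r²/4 is given up to absorb the quartic error. -/
theorem besselZero_le_exp {r : ℝ} (hr0 : 0 ≤ r) (hr1 : r ≤ 1) :
    besselZero r ≤ Real.exp (-(r ^ 2 / 8)) := by
  have h := (abs_le.mp (abs_besselZero_sub_le hr0 hr1)).2
  have h2 : r ^ 2 ≤ 1 := pow_le_one₀ hr0 hr1
  have h4 : r ^ 4 ≤ r ^ 2 := pow_le_pow_of_le_one hr0 hr1 (by norm_num)
  have := Real.add_one_le_exp (-(r ^ 2 / 8))
  have := sq_nonneg r
  linarith

theorem abs_besselZero_sub_exp_le {r : ℝ} (hr0 : 0 ≤ r) (hr1 : r ≤ 1) :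
    |besselZero r - Real.exp (-(r ^ 2 / 4))| ≤ r ^ 4 := by
  have h := abs_besselZero_sub_le hr0 hr1
  have h2 : r ^ 2 ≤ 1 := pow_le_one₀ hr0 hr1
  have h3 := Real.abs_exp_sub_one_sub_id_le (x := -(r ^ 2 / 4))
    (by rw [abs_neg, abs_of_nonneg (by positivity)]; linarith)
  have h5 : besselZero r - Real.exp (-(r ^ 2 / 4)) = (besselZero r - (1 - r ^ 2 / 4))
    - (Real.exp (-(r ^ 2 / 4)) - 1 - -(r ^ 2 / 4)) := by ring
  rw [h5]
  refine (abs_sub _ _).trans ?_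
  have : 0 ≤ r ^ 4 := by positivity
  nlinarith

/-- Integration by parts away from the stationary points: sin θ · cos(r cos θ) is the derivative of
-sin(r cos θ)/r, and 1/sin θ is controlled on the interval. -/
theorem abs_integral_cos_mul_cos_le {r ε : ℝ} (hr : 0 < r) (hε : 0 < ε) (hε' : ε ≤ 1) (a : ℝ)
    (ha : ∀ θ ∈ Set.Icc (a + ε) (a + Real.pi - ε), Real.sin ε ≤ |Real.sin θ|) :
    |∫ θ in (a + ε)..(a + Real.pi - ε), Real.cos (r * Real.cos θ)| ≤
      2 / (r * Real.sin ε) + Real.pi / (r * Real.sin ε ^ 2) := by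
  have hpi := Real.pi_gt_three
  have hs : 0 < Real.sin ε := Real.sin_pos_of_pos_of_lt_pi hε (by linarith)
  have hle : a + ε ≤ a + Real.pi - ε := by linarith
  have hs0 : ∀ θ ∈ Set.Icc (a + ε) (a + Real.pi - ε), Real.sin θ ≠ 0 := fun θ hθ =>
    abs_pos.mp (hs.trans_le (ha θ hθ))
  have hu : ∀ θ ∈ Set.uIcc (a + ε) (a + Real.pi - ε),
      HasDerivAt (fun θ => (Real.sin θ)⁻¹) (-Real.cos θ / Real.sin θ ^ 2) θ := by
    intro θ hθ
    rw [Set.uIcc_of_le hle] at hθ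
    exact (Real.hasDerivAt_sin θ).inv (hs0 θ hθ)
  have hv : ∀ θ ∈ Set.uIcc (a + ε) (a + Real.pi - ε),
      HasDerivAt (fun θ => -(Real.sin (r * Real.cos θ) / r))
        (Real.sin θ * Real.cos (r * Real.cos θ)) θ := by
    intro θ _
    have := ((((Real.hasDerivAt_cos θ).const_mul r).sin).div_const r).neg
    refine this.congr_deriv ?_
    field_simp
  have hcu : ContinuousOn (fun θ => -Real.cos θ / Real.sin θ ^ 2)
      (Set.uIcc (a + ε) (a + Real.pi - ε)) := by
    rw [Set.uIcc_of_le hle]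
    exact ContinuousOn.div (by fun_prop) (by fun_prop) (fun θ hθ => pow_ne_zero 2 (hs0 θ hθ))
  have hibp := intervalIntegral.integral_mul_deriv_eq_deriv_mul hu hv hcu.intervalIntegrable
    (Continuous.intervalIntegrable (by fun_prop) _ _)
  have hcongr : ∫ θ in (a + ε)..(a + Real.pi - ε), Real.cos (r * Real.cos θ) =
      ∫ θ in (a + ε)..(a + Real.pi - ε),
        (Real.sin θ)⁻¹ * (Real.sin θ * Real.cos (r * Real.cos θ)) := by
    refine intervalIntegral.integral_congr fun θ hθ => ?_
    rw [Set.uIcc_of_le hle] at hθ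
    have := hs0 θ hθ
    field_simp
  rw [hcongr, hibp]
  have hbd : ∀ θ ∈ Set.Icc (a + ε) (a + Real.pi - ε),
      |(Real.sin θ)⁻¹ * -(Real.sin (r * Real.cos θ) / r)| ≤ 1 / (r * Real.sin ε) := by
    intro θ hθ
    have h1 := ha θ hθ
    have h2 : |(Real.sin θ)⁻¹| ≤ (Real.sin ε)⁻¹ := by
      rw [abs_inv]; exact inv_anti₀ hs h1
    have h3 : |-(Real.sin (r * Real.cos θ) / r)| ≤ r⁻¹ := by
      rw [abs_neg, abs_div, abs_of_pos hr, div_eq_mul_inv]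
      exact mul_le_of_le_one_left (by positivity) (Real.abs_sin_le_one _)
    rw [abs_mul]
    calc _ ≤ (Real.sin ε)⁻¹ * r⁻¹ := mul_le_mul h2 h3 (abs_nonneg _) (by positivity)
      _ = _ := by field_simp
  have hint : |∫ θ in (a + ε)..(a + Real.pi - ε),
      -Real.cos θ / Real.sin θ ^ 2 * -(Real.sin (r * Real.cos θ) / r)| ≤
      Real.pi / (r * Real.sin ε ^ 2) := by
    have := intervalIntegral.norm_integral_le_of_norm_le_const (a := a + ε)
      (b := a + Real.pi - ε)
      (f := fun θ => -Real.cos θ / Real.sin θ ^ 2 * -(Real.sin (r * Real.cos θ) / r))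
      (C := 1 / (r * Real.sin ε ^ 2)) (by
        intro θ hθ
        rw [Set.uIoc_of_le hle] at hθ
        have h1 := ha θ ⟨hθ.1.le, hθ.2⟩
        have h1' : Real.sin ε ^ 2 ≤ Real.sin θ ^ 2 := by
          rw [← sq_abs (Real.sin θ)]; exact pow_le_pow_left₀ hs.le h1 2
        have h2 : |-Real.cos θ / Real.sin θ ^ 2| ≤ (Real.sin ε ^ 2)⁻¹ := by
          rw [abs_div, abs_neg, abs_of_nonneg (sq_nonneg (Real.sin θ)), div_eq_mul_inv]
          calc _ ≤ 1 * (Real.sin ε ^ 2)⁻¹ := mul_le_mul (Real.abs_cos_le_one _)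
                (inv_anti₀ (by positivity) h1') (by positivity) zero_le_one
            _ = _ := one_mul _
        have h3 : |-(Real.sin (r * Real.cos θ) / r)| ≤ r⁻¹ := by
          rw [abs_neg, abs_div, abs_of_pos hr, div_eq_mul_inv]
          exact mul_le_of_le_one_left (by positivity) (Real.abs_sin_le_one _)
        rw [Real.norm_eq_abs, abs_mul]
        calc _ ≤ (Real.sin ε ^ 2)⁻¹ * r⁻¹ := mul_le_mul h2 h3 (abs_nonneg _) (by positivity)
          _ = _ := by field_simp)
    rw [Real.norm_eq_abs] at this
    refine this.trans ?_
    rw [abs_of_nonneg (by linarith), one_div, inv_mul_eq_div]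
    gcongr
    linarith
  have h1 := hbd (a + Real.pi - ε) ⟨hle, le_rfl⟩
  have h2 := hbd (a + ε) ⟨le_rfl, hle⟩
  refine (abs_sub _ _).trans ?_
  refine add_le_add ((abs_sub _ _).trans ?_) hint
  calc _ ≤ 1 / (r * Real.sin ε) + 1 / (r * Real.sin ε) := add_le_add h1 h2
    _ = _ := by ring

theorem besselZero_eq_integral_zero_pi (r : ℝ) :
    besselZero r = Real.pi⁻¹ * ∫ θ in (0 : ℝ)..Real.pi, Real.cos (r * Real.cos θ) := by
  have hpi := Real.pi_pos
  have hper : Function.Periodic (fun θ => Real.cos (r * Real.cos θ)) Real.pi := by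
    intro θ
    simp [Real.cos_add_pi]
  have h := hper.intervalIntegral_add_eq 0 Real.pi
  rw [besselZero, ← intervalIntegral.integral_add_adjacent_intervals
    (besselZero_intervalIntegrable r 0 Real.pi)
    (besselZero_intervalIntegrable r Real.pi (2 * Real.pi))]
  rw [zero_add, ← two_mul] at h
  rw [← h]
  field_simp
  ring

/-- Cutting at distance 1/t from the stationary points balances the two parts: the ends have length
1/t, and the oscillatory bound in between is of order 1/(t³ · t⁻²). The sharp rate r^(-1/2) is not
needed; any power decay suffices. -/
theorem abs_besselZero_le_div {t : ℝ} (ht : 1 ≤ t) : |besselZero (t ^ 3)| ≤ 10 / t := by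
  have hpi := Real.pi_gt_three
  have hpi4 := Real.pi_lt_four
  have ht0 : 0 < t := by linarith
  have hε' : t⁻¹ ≤ 1 := inv_le_one_of_one_le₀ ht
  have hε : 0 < t⁻¹ := by positivity
  have hsε : 2 / Real.pi * t⁻¹ ≤ Real.sin t⁻¹ := Real.mul_le_sin hε.le (by linarith)
  have hsε2 : t⁻¹ / 2 ≤ Real.sin t⁻¹ := by
    refine le_trans ?_ hsε
    rw [div_mul_eq_mul_div, div_le_div_iff₀ (by norm_num) (by positivity)]
    nlinarith
  have h := abs_integral_cos_mul_cos_le (r := t ^ 3) (by positivity) hε hε' 0 (by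
    intro θ hθ
    rw [zero_add, zero_add] at hθ
    refine le_trans ?_ (le_abs_self _)
    rcases le_total θ (Real.pi / 2) with h | h
    · exact Real.sin_le_sin_of_le_of_le_pi_div_two (by linarith) h hθ.1
    · rw [← Real.sin_pi_sub θ]
      exact Real.sin_le_sin_of_le_of_le_pi_div_two (by linarith) (by linarith) (by linarith [hθ.2]))
  rw [zero_add, zero_add] at h
  have hh : 2 / (t ^ 3 * Real.sin t⁻¹) + Real.pi / (t ^ 3 * Real.sin t⁻¹ ^ 2) ≤ 20 / t := by
    have e1 : 2 / (t ^ 3 * Real.sin t⁻¹) ≤ 2 / (t ^ 3 * (t⁻¹ / 2)) := by gcongr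
    have e2 : Real.pi / (t ^ 3 * Real.sin t⁻¹ ^ 2) ≤ 4 / (t ^ 3 * (t⁻¹ / 2) ^ 2) := by gcongr
    have e3 : 2 / (t ^ 3 * (t⁻¹ / 2)) = 4 / t ^ 2 := by field_simp; norm_num
    have e4 : 4 / (t ^ 3 * (t⁻¹ / 2) ^ 2) = 16 / t := by field_simp; norm_num
    have e5 : 4 / t ^ 2 ≤ 4 / t := by
      gcongr
      exact le_self_pow₀ ht (by norm_num)
    have : 20 / t = 4 / t + 16 / t := by ring
    linarith
  have hb : ∀ a b : ℝ, |∫ θ in a..b, Real.cos (t ^ 3 * Real.cos θ)| ≤ |b - a| := by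
    intro a b
    have := intervalIntegral.norm_integral_le_of_norm_le_const (a := a) (b := b)
      (f := fun θ => Real.cos (t ^ 3 * Real.cos θ)) (C := 1)
      (fun θ _ => by simpa using Real.abs_cos_le_one _)
    simpa using this
  have h1 := hb 0 t⁻¹
  have h2 := hb (Real.pi - t⁻¹) Real.pi
  rw [sub_zero, abs_of_pos hε] at h1
  rw [sub_sub_cancel, abs_of_pos hε] at h2
  rw [besselZero_eq_integral_zero_pi, ← intervalIntegral.integral_add_adjacent_intervals
    (besselZero_intervalIntegrable _ 0 t⁻¹) (besselZero_intervalIntegrable _ t⁻¹ Real.pi),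
    ← intervalIntegral.integral_add_adjacent_intervals
    (besselZero_intervalIntegrable _ t⁻¹ (Real.pi - t⁻¹))
    (besselZero_intervalIntegrable _ (Real.pi - t⁻¹) Real.pi), abs_mul,
    abs_of_pos (by positivity : 0 < Real.pi⁻¹), inv_mul_le_iff₀ (by positivity)]
  refine (abs_add_le _ _).trans ?_
  have h3 := (abs_add_le (∫ θ in t⁻¹..(Real.pi - t⁻¹), Real.cos (t ^ 3 * Real.cos θ))
    (∫ θ in (Real.pi - t⁻¹)..Real.pi, Real.cos (t ^ 3 * Real.cos θ)))
  have h4 : 20 / t + 2 * t⁻¹ = 22 * t⁻¹ := by ring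
  have h5 : Real.pi * (10 / t) = Real.pi * 10 * t⁻¹ := by ring
  rw [h5]
  nlinarith

/-- With decay r^(-1/3), twelve factors give r⁻⁴, which is integrable at infinity in the plane even
after multiplication by r. -/
theorem abs_besselZero_pow_le {r : ℝ} (hr : 1 ≤ r) : |besselZero r| ^ 12 ≤ 10 ^ 12 / r ^ 4 := by
  have hr0 : 0 ≤ r := by linarith
  have h1 : 1 ≤ r ^ (3⁻¹ : ℝ) := Real.one_le_rpow hr (by norm_num)
  have h3 : (r ^ (3⁻¹ : ℝ)) ^ 3 = r := by
    have := Real.rpow_inv_natCast_pow hr0 (n := 3) (by norm_num)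
    simpa using this
  have h := abs_besselZero_le_div h1
  rw [h3] at h
  calc _ ≤ (10 / r ^ (3⁻¹ : ℝ)) ^ 12 := pow_le_pow_left₀ (abs_nonneg _) h 12
    _ = 10 ^ 12 / ((r ^ (3⁻¹ : ℝ)) ^ 3) ^ 4 := by rw [div_pow, ← pow_mul]
    _ = _ := by rw [h3]

theorem exists_abs_besselZero_le :
    ∃ ρ : ℝ, 0 < ρ ∧ ρ < 1 ∧ ∀ r, 1 ≤ r → |besselZero r| ≤ ρ := by
  have key : ∀ k : ℕ, ∃ ρ : ℝ, 0 < ρ ∧ ρ < 1 ∧ ∀ r, (20 : ℝ) ^ 3 / 2 ^ k ≤ r →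
      |besselZero r| ≤ ρ := by
    intro k
    induction k with
    | zero =>
      refine ⟨1 / 2, by norm_num, by norm_num, fun r hr => ?_⟩
      have hr' : (20 : ℝ) ^ 3 ≤ r := by simpa using hr
      have hr0 : 0 ≤ r := by linarith
      have h3 : (r ^ (3⁻¹ : ℝ)) ^ 3 = r := by
        have := Real.rpow_inv_natCast_pow hr0 (n := 3) (by norm_num)
        simpa using this
      have h20 : 20 ≤ r ^ (3⁻¹ : ℝ) := by
        refine le_of_pow_le_pow_left₀ (n := 3) (by norm_num) (by positivity) ?_
        rwa [h3]
      have h := abs_besselZero_le_div (t := r ^ (3⁻¹ : ℝ)) (by linarith)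
      rw [h3] at h
      refine h.trans ?_
      rw [div_le_div_iff₀ (by linarith) (by norm_num)]
      linarith
    | succ k ih =>
      obtain ⟨ρ, h0, h1, h⟩ := ih
      refine ⟨Real.sqrt ((1 + ρ) / 2), by positivity, ?_, fun r hr => ?_⟩
      · rw [Real.sqrt_lt' one_pos]; linarith
      · refine Real.abs_le_sqrt ((besselZero_sq_le r).trans ?_)
        have h2 := h (2 * r) (by
          rw [pow_succ (2 : ℝ), ← div_div] at hr
          linarith)
        linarith [le_abs_self (besselZero (2 * r))]
  -- Thirteen halvings bring the threshold below 1, since 20³ = 8000 < 8192 = 2¹³.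
  obtain ⟨ρ, h0, h1, h⟩ := key 13
  exact ⟨ρ, h0, h1, fun r hr => h r (le_trans (by norm_num) hr)⟩

/-! ### The uniform law on the circle -/

/-- The point of the unit circle with angle `θ`. -/
noncomputable def circlePoint (θ : ℝ) : Plane := !₂[Real.cos θ, Real.sin θ]

theorem continuous_circlePoint : Continuous circlePoint := by
  unfold circlePoint
  refine (PiLp.continuous_toLp 2 (fun _ : Fin 2 => ℝ)).comp (continuous_pi fun i => ?_)
  fin_cases i <;> simp <;> fun_prop

theorem uniformUnitCircle_eq :
    uniformUnitCircle = (ProbabilityTheory.cond (volume : Measure ℝ)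
      (Set.Ico 0 (2 * Real.pi))).map circlePoint := rfl

instance : IsProbabilityMeasure (ProbabilityTheory.cond (volume : Measure ℝ)
    (Set.Ico 0 (2 * Real.pi))) :=
  cond_isProbabilityMeasure_of_finite (by simp [Real.pi_pos]) (by rw [Real.volume_Ico]; exact ENNReal.ofReal_ne_top)

instance : IsProbabilityMeasure uniformUnitCircle := by
  rw [uniformUnitCircle_eq]
  exact Measure.isProbabilityMeasure_map continuous_circlePoint.measurable.aemeasurable

theorem integral_uniformUnitCircle {E : Type*} [NormedAddCommGroup E] [NormedSpace ℝ E]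
    {f : Plane → E} (hf : StronglyMeasurable f) :
    ∫ x, f x ∂uniformUnitCircle =
      (2 * Real.pi)⁻¹ • ∫ θ in (0 : ℝ)..(2 * Real.pi), f (circlePoint θ) := by
  have hpi := Real.pi_pos
  rw [uniformUnitCircle_eq, integral_map continuous_circlePoint.measurable.aemeasurable
    hf.aestronglyMeasurable, ProbabilityTheory.cond, integral_smul_measure,
    intervalIntegral.integral_of_le (by positivity), integral_Ico_eq_integral_Ioc]
  congr 1
  rw [Real.volume_Ico, sub_zero, ENNReal.toReal_inv, ENNReal.toReal_ofReal (by positivity)]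

theorem ae_uniformUnitCircle_of_circlePoint {p : Plane → Prop} (hp : MeasurableSet {x | p x})
    (h : ∀ θ, p (circlePoint θ)) : ∀ᵐ x ∂uniformUnitCircle, p x := by
  rw [uniformUnitCircle_eq]
  exact (ae_map_iff continuous_circlePoint.measurable.aemeasurable hp).2 (ae_of_all _ h)

theorem norm_circlePoint (θ : ℝ) : ‖circlePoint θ‖ = 1 := by
  simp [circlePoint, EuclideanSpace.norm_eq]

theorem ae_norm_eq_one_uniformUnitCircle : ∀ᵐ x ∂uniformUnitCircle, ‖x‖ = 1 :=
  ae_uniformUnitCircle_of_circlePoint (measurableSet_eq_fun measurable_norm measurable_const)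
    norm_circlePoint

theorem exists_eq_smul_circlePoint (a : Plane) : ∃ α, a = ‖a‖ • circlePoint α := by
  set z : ℂ := ⟨a 0, a 1⟩ with hz
  have hn : ‖z‖ = ‖a‖ := by
    rw [EuclideanSpace.norm_eq, Complex.norm_def, Complex.normSq_apply]
    simp [hz, pow_two]
  refine ⟨z.arg, ?_⟩
  ext i
  fin_cases i
  · simp [circlePoint, ← hn, Complex.norm_mul_cos_arg, hz]
  · simp [circlePoint, ← hn, Complex.norm_mul_sin_arg, hz]

theorem inner_circlePoint (α θ : ℝ) : inner ℝ (circlePoint θ) (circlePoint α) =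
    Real.cos (θ - α) := by
  simp [circlePoint, PiLp.inner_apply, Fin.sum_univ_two, Real.cos_sub]
  ring

/-- Rotating the angle reduces t to its norm; the imaginary part vanishes because sin(‖t‖ cos θ)
changes sign under θ ↦ θ + π. -/
theorem charFun_uniformUnitCircle (t : Plane) :
    charFun uniformUnitCircle t = (besselZero ‖t‖ : ℂ) := by
  have hpi := Real.pi_pos
  obtain ⟨α, hα⟩ := exists_eq_smul_circlePoint t
  rw [charFun_apply, integral_uniformUnitCircle (by fun_prop)]
  have h1 : ∀ θ, inner ℝ (circlePoint θ) t = ‖t‖ * Real.cos (θ - α) := by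
    intro θ
    rw [hα, inner_smul_right, inner_circlePoint, norm_smul, norm_circlePoint]
    simp
  simp_rw [h1]
  set g : ℝ → ℂ := fun θ => Complex.exp (((‖t‖ * Real.cos θ : ℝ) : ℂ) * Complex.I) with hg
  have hper : Function.Periodic g (2 * Real.pi) := by
    intro θ
    simp only [hg, Real.cos_add_two_pi]
  have hgc : Continuous g := by fun_prop
  have h2 : ∫ θ in (0 : ℝ)..(2 * Real.pi), g (θ - α) = ∫ θ in (0 : ℝ)..(2 * Real.pi), g θ := by
    rw [intervalIntegral.integral_comp_sub_right g α, zero_sub]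
    have := hper.intervalIntegral_add_eq (-α) 0
    rw [zero_add] at this
    rw [← this]
    congr 1
    ring
  change (2 * Real.pi)⁻¹ • ∫ θ in (0 : ℝ)..(2 * Real.pi), g (θ - α) = _
  rw [h2]
  have h3 : ∀ θ, g θ = (Real.cos (‖t‖ * Real.cos θ) : ℂ)
      + (Real.sin (‖t‖ * Real.cos θ) : ℂ) * Complex.I := by
    intro θ
    simp only [hg, Complex.exp_mul_I, Complex.ofReal_cos, Complex.ofReal_sin]
  have h4 : ∫ θ in (0 : ℝ)..(2 * Real.pi), Real.sin (‖t‖ * Real.cos θ) = 0 := by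
    have hanti : Function.Antiperiodic (fun θ => Real.sin (‖t‖ * Real.cos θ)) Real.pi := by
      intro θ
      simp [Real.cos_add_pi]
    rw [← intervalIntegral.integral_add_adjacent_intervals (b := Real.pi)
      (Continuous.intervalIntegrable (by fun_prop) _ _)
      (Continuous.intervalIntegrable (by fun_prop) _ _)]
    have := intervalIntegral.integral_comp_add_right (a := 0) (b := Real.pi)
      (fun θ => Real.sin (‖t‖ * Real.cos θ)) Real.pi
    rw [zero_add, ← two_mul] at this
    rw [← this]
    have h5 : ∀ θ, Real.sin (‖t‖ * Real.cos (θ + Real.pi)) = -Real.sin (‖t‖ * Real.cos θ) :=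
      hanti
    simp_rw [h5]
    rw [intervalIntegral.integral_neg]
    ring
  simp_rw [h3]
  rw [intervalIntegral.integral_add (Continuous.intervalIntegrable (by fun_prop) _ _)
    (Continuous.intervalIntegrable (by fun_prop) _ _), intervalIntegral.integral_mul_const,
    intervalIntegral.integral_ofReal, intervalIntegral.integral_ofReal, h4, besselZero]
  simp

theorem countable_setOf_cos_eq (c : ℝ) : {θ : ℝ | Real.cos θ = c}.Countable := by
  by_cases hc : ∃ β, Real.cos β = c
  · obtain ⟨β, rfl⟩ := hc
    refine Set.Countable.mono (s₂ := (Set.range fun k : ℤ => 2 * k * Real.pi + β) ∪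
      (Set.range fun k : ℤ => 2 * k * Real.pi - β)) ?_
      ((Set.countable_range _).union (Set.countable_range _))
    intro θ hθ
    obtain ⟨k, hk | hk⟩ := Real.cos_eq_cos_iff.1 (Eq.symm hθ)
    · exact Or.inl ⟨k, hk.symm⟩
    · exact Or.inr ⟨k, hk.symm⟩
  · push Not at hc
    have : {θ : ℝ | Real.cos θ = c} = ∅ := Set.eq_empty_of_forall_notMem fun θ hθ => hc θ hθ
    rw [this]
    exact Set.countable_empty

/-- In the angle, the condition prescribes the value of a cosine and so has countably many
solutions. This makes boundaries of parallelograms and parallel pairs of steps negligible. -/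
theorem uniformUnitCircle_line {a : Plane} (ha : a ≠ 0) (c : ℝ) :
    uniformUnitCircle {x | inner ℝ x a = c} = 0 := by
  obtain ⟨α, hα⟩ := exists_eq_smul_circlePoint a
  have hn : ‖a‖ ≠ 0 := norm_ne_zero_iff.2 ha
  rw [uniformUnitCircle_eq, Measure.map_apply continuous_circlePoint.measurable
    (measurableSet_eq_fun (by fun_prop) measurable_const), ProbabilityTheory.cond,
    Measure.smul_apply, smul_eq_mul]
  refine mul_eq_zero_of_right _ (measure_mono_null (t := (fun θ => θ - α) ⁻¹'
    {θ | Real.cos θ = c / ‖a‖}) ?_ ?_)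
  · intro θ hθ
    have h1 : inner ℝ (circlePoint θ) a = c := hθ
    rw [hα, inner_smul_right, inner_circlePoint] at h1
    change Real.cos (θ - α) = _
    rw [eq_div_iff hn, mul_comm]
    exact h1
  · exact Measure.absolutelyContinuous_of_le Measure.restrict_le_self ((Set.Countable.preimage_of_injOn
      (countable_setOf_cos_eq _) (sub_left_injective.injOn)).measure_zero _)

/-! ### Determinants and their mean -/

/-- The determinant of two vectors of the plane. -/
def planeDet (u v : Plane) : ℝ := u 0 * v 1 - u 1 * v 0

theorem continuous_planeDet : Continuous fun p : Plane × Plane => planeDet p.1 p.2 := by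
  unfold planeDet
  fun_prop

theorem abs_planeDet_le (u v : Plane) : |planeDet u v| ≤ ‖u‖ * ‖v‖ := by
  refine abs_le_of_sq_le_sq ?_ (by positivity)
  rw [mul_pow, EuclideanSpace.norm_sq_eq, EuclideanSpace.norm_sq_eq, planeDet]
  simp only [Fin.sum_univ_two, Real.norm_eq_abs, sq_abs]
  nlinarith [sq_nonneg (u 0 * v 0 + u 1 * v 1)]

theorem planeDet_circlePoint (α θ : ℝ) :
    planeDet (circlePoint α) (circlePoint θ) = Real.sin (θ - α) := by
  simp [planeDet, circlePoint, Real.sin_sub]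
  ring

theorem integral_abs_sin_zero_two_pi :
    ∫ θ in (0 : ℝ)..(2 * Real.pi), |Real.sin θ| = 4 := by
  have hpi := Real.pi_pos
  have hc : Continuous fun θ => |Real.sin θ| := by fun_prop
  have hper : Function.Periodic (fun θ => |Real.sin θ|) Real.pi := by
    intro θ
    simp [Real.sin_add_pi]
  have h := hper.intervalIntegral_add_eq 0 Real.pi
  rw [zero_add, ← two_mul] at h
  rw [← intervalIntegral.integral_add_adjacent_intervals (hc.intervalIntegrable 0 Real.pi)
    (hc.intervalIntegrable Real.pi (2 * Real.pi)), ← h]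
  have : ∫ θ in (0 : ℝ)..Real.pi, |Real.sin θ| = ∫ θ in (0 : ℝ)..Real.pi, Real.sin θ := by
    refine intervalIntegral.integral_congr fun θ hθ => ?_
    rw [Set.uIcc_of_le hpi.le] at hθ
    exact abs_of_nonneg (Real.sin_nonneg_of_mem_Icc hθ)
  rw [this, integral_sin]
  norm_num

theorem integral_abs_planeDet :
    ∫ p, |planeDet p.1 p.2| ∂(uniformUnitCircle.prod uniformUnitCircle) = 2 / Real.pi := by
  have hpi := Real.pi_pos
  have hc : Continuous fun p : Plane × Plane => |planeDet p.1 p.2| := continuous_planeDet.abs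
  have hint : Integrable (fun p : Plane × Plane => |planeDet p.1 p.2|)
      (uniformUnitCircle.prod uniformUnitCircle) := by
    refine Integrable.mono' (integrable_const (1 : ℝ)) hc.aestronglyMeasurable ?_
    filter_upwards [Measure.quasiMeasurePreserving_fst.ae ae_norm_eq_one_uniformUnitCircle,
      Measure.quasiMeasurePreserving_snd.ae ae_norm_eq_one_uniformUnitCircle] with p h1 h2
    have := abs_planeDet_le p.1 p.2
    rw [h1, h2] at this
    simpa using this
  rw [integral_prod _ hint]
  have h1 : ∀ᵐ u ∂uniformUnitCircle,
      ∫ v, |planeDet u v| ∂uniformUnitCircle = 2 / Real.pi := by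
    refine ae_uniformUnitCircle_of_circlePoint ?_ fun α => ?_
    · exact (hc.stronglyMeasurable.integral_prod_right'.measurable) (measurableSet_singleton _)
    rw [integral_uniformUnitCircle (f := fun v => |planeDet (circlePoint α) v|)
      (hc.comp (Continuous.prodMk_right (circlePoint α))).stronglyMeasurable]
    simp_rw [planeDet_circlePoint]
    have hper : Function.Periodic (fun θ => |Real.sin θ|) (2 * Real.pi) := by
      intro θ
      simp
    have h2 := hper.intervalIntegral_add_eq (-α) 0
    rw [zero_add, integral_abs_sin_zero_two_pi] at h2
    rw [intervalIntegral.integral_comp_sub_right (fun θ => |Real.sin θ|) α, zero_sub,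
      sub_eq_neg_add, h2, smul_eq_mul]
    field_simp
    norm_num
  rw [integral_congr_ae h1]
  simp

/-! ### Fourier inversion for the mass of a set -/

section FourierInversion

open scoped FourierTransform

/-- Dominated convergence: the indicator is discontinuous only on the frontier, which is null. -/
theorem continuousAt_integral_indicator_add {V : Type*} [NormedAddCommGroup V]
    [MeasurableSpace V] [BorelSpace V] {ν : Measure V} [IsProbabilityMeasure ν]
    {Q : Set V} (hQ : MeasurableSet Q) (hfr : ν (frontier Q) = 0) :
    ContinuousAt (fun x => ∫ s, Q.indicator (fun _ => (1 : ℂ)) (x + s) ∂ν) 0 := by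
  have hm : Measurable (Q.indicator fun _ => (1 : ℂ)) := measurable_const.indicator hQ
  refine continuousAt_of_dominated (bound := fun _ => 1) (Filter.Eventually.of_forall fun x =>
    (hm.comp (measurable_const_add x)).aestronglyMeasurable)
    (Filter.Eventually.of_forall fun x => Filter.Eventually.of_forall fun s => ?_)
    (integrable_const _) ?_
  · refine (norm_indicator_le_norm_self _ _).trans ?_
    simp
  · have : ∀ᵐ s ∂ν, s ∉ frontier Q := measure_eq_zero_iff_ae_notMem.1 hfr
    filter_upwards [this] with s hs
    have h1 : ContinuousAt (Q.indicator fun _ => (1 : ℂ)) (0 + s) := by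
      rw [zero_add]
      exact continuousOn_const.continuousAt_indicator hs
    exact ContinuousAt.comp (f := fun x => x + s) h1 (by fun_prop)

variable {V : Type*} [NormedAddCommGroup V] [InnerProductSpace ℝ V] [FiniteDimensional ℝ V]
  [MeasurableSpace V] [BorelSpace V]

/-- Inversion is applied to h(x) = ∫ 1_Q(x + s) dν(s), so no density of ν is required. By Fubini the
transform of h is the product in the integrand, and h(0) is the mass of Q; continuity of h at 0 is
what the null frontier supplies. -/
theorem measureReal_eq_integral_charFun_mul_fourier {ν : Measure V} [IsProbabilityMeasure ν]
    {Q : Set V} (hQ : MeasurableSet Q) (hvol : volume Q ≠ ⊤) (hfr : ν (frontier Q) = 0)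
    (hint : Integrable fun w => charFun ν ((2 * Real.pi) • w)) :
    (ν.real Q : ℂ) =
      ∫ w, charFun ν ((2 * Real.pi) • w) * 𝓕 (Q.indicator fun _ => (1 : ℂ)) w := by
  set f : V → ℂ := Q.indicator fun _ => (1 : ℂ) with hf
  have hfm : Measurable f := measurable_const.indicator hQ
  have hfi : Integrable f := (integrable_indicator_iff hQ).2 (integrableOn_const hvol)
  have hF : Integrable (fun p : V × V => f (p.1 + p.2)) (volume.prod ν) := by
    refine (integrable_prod_iff' (hfm.comp measurable_add).aestronglyMeasurable).2
      ⟨Filter.Eventually.of_forall fun s => hfi.comp_add_right s, ?_⟩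
    have : ∀ s, ∫ x, ‖f (x + s)‖ = ∫ x, ‖f x‖ := fun s =>
      integral_add_right_eq_self (fun x => ‖f x‖) s
    change Integrable (fun s => ∫ x, ‖f (x + s)‖) ν
    simp_rw [this]
    exact integrable_const _
  set h : V → ℂ := fun x => ∫ s, f (x + s) ∂ν with hh
  have hhi : Integrable h := hF.integral_prod_left
  have hFh : 𝓕 h = fun w => charFun ν ((2 * Real.pi) • w) * 𝓕 f w := by
    ext w
    rw [Real.fourier_eq]
    have e1 : ∀ x, Real.fourierChar (-(inner ℝ x w)) • h x =
        ∫ s, Real.fourierChar (-(inner ℝ x w)) • f (x + s) ∂ν := by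
      intro x
      simp_rw [hh, Circle.smul_def]
      rw [integral_smul]
    simp_rw [e1]
    rw [integral_integral_swap]
    · have e2 : ∀ s, ∫ x, Real.fourierChar (-(inner ℝ x w)) • f (x + s) =
          Real.fourierChar (inner ℝ s w) • 𝓕 f w := by
        intro s
        exact congrFun (VectorFourier.fourierIntegral_comp_add_right Real.fourierChar volume
          (innerₗ V) f s) w
      simp_rw [e2]
      rw [charFun_apply, ← integral_mul_const]
      congr 1
      ext s
      rw [Circle.smul_def, Real.fourierChar_apply, smul_eq_mul, inner_smul_right]
    · refine hF.mono ?_ (Filter.Eventually.of_forall fun p => ?_)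
      · exact AEStronglyMeasurable.smul (by fun_prop) hF.aestronglyMeasurable
      · simp [Function.uncurry]
  have hft : ∀ w, ‖𝓕 f w‖ ≤ ∫ x, ‖f x‖ := fun w =>
    VectorFourier.norm_fourierIntegral_le_integral_norm _ _ _ _ _
  have hFc : Continuous (𝓕 f) := VectorFourier.fourierIntegral_continuous
    Real.continuous_fourierChar continuous_inner hfi
  have hFhi : Integrable (𝓕 h) := by
    rw [hFh]
    exact hint.mul_bdd hFc.aestronglyMeasurable (Filter.Eventually.of_forall hft)
  have hinv := hhi.fourierInv_fourier_eq hFhi (continuousAt_integral_indicator_add hQ hfr)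
  rw [Real.fourierInv_eq] at hinv
  simp only [inner_zero_right, AddChar.map_zero_eq_one, one_smul] at hinv
  rw [hFh] at hinv
  rw [hinv, hh]
  simp only [zero_add]
  rw [hf, integral_indicator hQ]
  simp

theorem norm_fourier_indicator_sub_le {Q : Set V} (hQ : MeasurableSet Q) (hvol : volume Q ≠ ⊤)
    {R : ℝ} (hR : ∀ x ∈ Q, ‖x‖ ≤ R) (w : V) :
    ‖𝓕 (Q.indicator fun _ => (1 : ℂ)) w - (volume.real Q : ℂ)‖ ≤
      2 * Real.pi * R * ‖w‖ * volume.real Q := by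
  have e1 : 𝓕 (Q.indicator fun _ => (1 : ℂ)) w =
      ∫ x in Q, Complex.exp (Complex.I * ((-2 * Real.pi * inner ℝ x w : ℝ) : ℂ)) := by
    rw [Real.fourier_eq', ← integral_indicator hQ]
    congr 1
    ext x
    by_cases hx : x ∈ Q <;> simp [hx, mul_comm]
  have e2 : (volume.real Q : ℂ) = ∫ _ in Q, (1 : ℂ) := by simp
  have hfin : IsFiniteMeasure (volume.restrict Q) := ⟨by simpa using hvol.lt_top⟩
  rw [e1, e2, ← integral_sub]
  · refine (norm_setIntegral_le_of_norm_le_const hvol.lt_top (C := 2 * Real.pi * R * ‖w‖)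
      fun x hx => ?_)
    refine (Real.norm_exp_I_mul_ofReal_sub_one_le).trans ?_
    rw [Real.norm_eq_abs, abs_mul, abs_mul, abs_neg, abs_of_pos Real.pi_pos, abs_two, mul_assoc _ R]
    have := abs_real_inner_le_norm x w
    have := mul_le_mul_of_nonneg_right (hR x hx) (norm_nonneg w)
    have := Real.pi_pos
    gcongr
    linarith
  · refine Integrable.mono' (integrable_const (1 : ℝ)) ?_ (Filter.Eventually.of_forall fun x => ?_)
    · exact Continuous.aestronglyMeasurable (by fun_prop)
    · rw [mul_comm, Complex.norm_exp_ofReal_mul_I]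
  · exact integrable_const _

end FourierInversion

/-! ### Gaussian integrals and powers of J₀ -/

theorem integrable_norm_pow_mul_exp {c : ℝ} (hc : 0 < c) (k : ℕ) :
    Integrable fun w : Plane => ‖w‖ ^ k * Real.exp (-c * ‖w‖ ^ 2) := by
  rw [integrable_fun_norm_addHaar (μ := (volume : Measure Plane))
    (f := fun y => y ^ k * Real.exp (-c * y ^ 2))]
  have h := integrableOn_rpow_mul_exp_neg_mul_sq hc (s := ((k + 1 : ℕ) : ℝ))
    (by have : (0 : ℝ) ≤ ((k + 1 : ℕ) : ℝ) := by positivity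
        linarith)
  simp only [Real.rpow_natCast] at h
  convert h using 2 with y
  simp [pow_succ]
  ring

theorem integrable_norm_pow_mul_exp_nat {c : ℝ} (hc : 0 < c) (k : ℕ) {j : ℕ} (hj : 1 ≤ j) :
    Integrable fun w : Plane => ‖w‖ ^ k * Real.exp (-(j * c) * ‖w‖ ^ 2) :=
  integrable_norm_pow_mul_exp (mul_pos (by exact_mod_cast hj) hc) k

/-- Rescaling by √j; the exponent k + 2 contains the dimension of the plane. -/
theorem integral_norm_pow_mul_exp_nat (c : ℝ) (k : ℕ) {j : ℕ} (hj : 1 ≤ j) :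
    ∫ w : Plane, ‖w‖ ^ k * Real.exp (-(j * c) * ‖w‖ ^ 2) =
      ((√j) ^ (k + 2))⁻¹ * ∫ w : Plane, ‖w‖ ^ k * Real.exp (-c * ‖w‖ ^ 2) := by
  have hj0 : (0 : ℝ) < j := by exact_mod_cast hj
  have hs : 0 < √(j : ℝ) := Real.sqrt_pos.2 hj0
  have h := Measure.integral_comp_smul (volume : Measure Plane)
    (fun w : Plane => ‖w‖ ^ k * Real.exp (-c * ‖w‖ ^ 2)) (√j)
  have h2 : ∀ w : Plane, ‖√(j : ℝ) • w‖ ^ k * Real.exp (-c * ‖√(j : ℝ) • w‖ ^ 2) =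
      √(j : ℝ) ^ k * (‖w‖ ^ k * Real.exp (-(j * c) * ‖w‖ ^ 2)) := by
    intro w
    rw [norm_smul, Real.norm_of_nonneg hs.le, mul_pow, mul_pow, Real.sq_sqrt hj0.le]
    ring_nf
  simp_rw [h2] at h
  rw [integral_const_mul, finrank_euclideanSpace_fin, abs_of_pos (by positivity), smul_eq_mul] at h
  rw [pow_add, mul_inv, mul_assoc, ← h]
  field_simp

theorem integrable_one_add_norm_pow_inv {k : ℕ} (hk : 3 ≤ k) :
    Integrable fun w : Plane => ((1 + ‖w‖) ^ k)⁻¹ := by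
  have h := integrable_one_add_norm (E := Plane) (μ := volume) (r := k) (by
    rw [finrank_euclideanSpace_fin]
    exact_mod_cast hk)
  refine h.congr (Filter.Eventually.of_forall fun w => ?_)
  simp only
  rw [Real.rpow_neg (by positivity), Real.rpow_natCast]

theorem integrable_norm_mul_one_add_norm_pow_inv :
    Integrable fun w : Plane => ‖w‖ * ((1 + ‖w‖) ^ 4)⁻¹ := by
  refine (integrable_one_add_norm_pow_inv (k := 3) le_rfl).mono'
    (Measurable.aestronglyMeasurable (by fun_prop)) (Filter.Eventually.of_forall fun w => ?_)
  rw [Real.norm_of_nonneg (by positivity), ← div_eq_mul_inv, inv_eq_one_div,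
    div_le_div_iff₀ (by positivity) (by positivity), pow_succ (1 + ‖w‖) 3]
  have : 0 < (1 + ‖w‖) ^ 3 := by positivity
  nlinarith [norm_nonneg w]

/-- Twelve factors pay for integrability in x, and the remaining j - 12 are bounded by ρ each, which
gives geometric decay in j. -/
theorem abs_besselZero_pow_le_tail {ρ : ℝ} (hρ0 : 0 < ρ) (hρ1 : ρ < 1)
    (hρ : ∀ r, 1 ≤ r → |besselZero r| ≤ ρ) {j : ℕ} (hj : 13 ≤ j) {x : ℝ} (hx : 0 ≤ x)
    (hr : 1 ≤ 2 * Real.pi * x) :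
    |besselZero (2 * Real.pi * x)| ^ j ≤ 16 * (10 / ρ) ^ 12 * ρ ^ j * ((1 + x) ^ 4)⁻¹ := by
  have hpi := Real.pi_gt_three
  set r := 2 * Real.pi * x with hr'
  obtain ⟨m, rfl⟩ := Nat.exists_eq_add_of_le (le_trans (by norm_num : 12 ≤ 13) hj)
  rw [pow_add, pow_add ρ]
  have h1 := abs_besselZero_pow_le hr
  have h2 : |besselZero r| ^ m ≤ ρ ^ m := pow_le_pow_left₀ (abs_nonneg _) (hρ r hr) m
  have h3 : 10 ^ 12 / r ^ 4 ≤ 16 * 10 ^ 12 * ((1 + x) ^ 4)⁻¹ := by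
    have h4 : 1 + x ≤ 2 * r := by nlinarith
    have h5 : (1 + x) ^ 4 ≤ (2 * r) ^ 4 := pow_le_pow_left₀ (by positivity) h4 4
    rw [← div_eq_mul_inv, div_le_div_iff₀ (by positivity) (by positivity)]
    rw [mul_pow] at h5
    linarith
  calc _ ≤ (16 * 10 ^ 12 * ((1 + x) ^ 4)⁻¹) * ρ ^ m :=
        mul_le_mul (h1.trans h3) h2 (by positivity) (by positivity)
    _ = _ := by field_simp

theorem abs_besselZero_pow_le_add {ρ : ℝ} (hρ0 : 0 < ρ) (hρ1 : ρ < 1)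
    (hρ : ∀ r, 1 ≤ r → |besselZero r| ≤ ρ) {j : ℕ} (hj : 13 ≤ j) {x : ℝ} (hx : 0 ≤ x) :
    |besselZero (2 * Real.pi * x)| ^ j ≤
      Real.exp (-(j * (Real.pi ^ 2 / 2)) * x ^ 2)
        + 16 * (10 / ρ) ^ 12 * ρ ^ j * ((1 + x) ^ 4)⁻¹ := by
  have hpi := Real.pi_gt_three
  rcases le_total (2 * Real.pi * x) 1 with hr | hr
  · have h0 : 0 ≤ 2 * Real.pi * x := by positivity
    refine le_trans ?_ (le_add_of_nonneg_right (by positivity))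
    rw [abs_of_nonneg (besselZero_nonneg h0 hr)]
    refine (pow_le_pow_left₀ (besselZero_nonneg h0 hr) (besselZero_le_exp h0 hr) j).trans ?_
    rw [← Real.exp_nat_mul]
    apply le_of_eq
    congr 1
    ring
  · exact (abs_besselZero_pow_le_tail hρ0 hρ1 hρ hj hx hr).trans
      (le_add_of_nonneg_left (Real.exp_pos _).le)

/-- For small x, |a^j - b^j| ≤ |a - b| · j · max^(j-1) with both bases at most exp(-r²/8); restoring
the missing factor costs 2, as exp(-r²/8) ≥ 1/2. For large x the two powers are bounded separately,
the Gaussian going into the first term because (2πx)⁴ ≥ 1. -/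
theorem abs_besselZero_pow_sub_exp_le {ρ : ℝ} (hρ0 : 0 < ρ) (hρ1 : ρ < 1)
    (hρ : ∀ r, 1 ≤ r → |besselZero r| ≤ ρ) {j : ℕ} (hj : 13 ≤ j) {x : ℝ} (hx : 0 ≤ x) :
    |besselZero (2 * Real.pi * x) ^ j - Real.exp (-(j * Real.pi ^ 2) * x ^ 2)| ≤
      2 * (2 * Real.pi) ^ 4 * j * (x ^ 4 * Real.exp (-(j * (Real.pi ^ 2 / 2)) * x ^ 2))
        + 16 * (10 / ρ) ^ 12 * ρ ^ j * ((1 + x) ^ 4)⁻¹ := by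
  have hpi := Real.pi_gt_three
  have hj1 : (1 : ℝ) ≤ j := by exact_mod_cast (le_trans (by norm_num) hj)
  rcases le_total (2 * Real.pi * x) 1 with hr | hr
  · have h0 : 0 ≤ 2 * Real.pi * x := by positivity
    refine le_trans ?_ (le_add_of_nonneg_right (by positivity))
    set r := 2 * Real.pi * x with hr'
    have e1 : Real.exp (-(j * Real.pi ^ 2) * x ^ 2) = Real.exp (-(r ^ 2 / 4)) ^ j := by
      rw [← Real.exp_nat_mul]
      congr 1
      rw [hr']
      ring
    have e2 : Real.exp (-(j * (Real.pi ^ 2 / 2)) * x ^ 2) =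
        Real.exp (-(r ^ 2 / 8)) ^ (j - 1) * Real.exp (-(r ^ 2 / 8)) := by
      rw [← pow_succ, Nat.sub_add_cancel (le_trans (by norm_num) hj), ← Real.exp_nat_mul]
      congr 1
      rw [hr']
      ring
    have hmax : max |besselZero r| |Real.exp (-(r ^ 2 / 4))| ≤ Real.exp (-(r ^ 2 / 8)) := by
      refine max_le ?_ ?_
      · rw [abs_of_nonneg (besselZero_nonneg h0 hr)]
        exact besselZero_le_exp h0 hr
      · rw [abs_of_pos (Real.exp_pos _), Real.exp_le_exp]
        nlinarith [sq_nonneg r]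
    have hexp : 1 / 2 ≤ Real.exp (-(r ^ 2 / 8)) := by
      have := Real.add_one_le_exp (-(r ^ 2 / 8))
      have : r ^ 2 ≤ 1 := pow_le_one₀ h0 hr
      linarith
    rw [e1, e2]
    refine (abs_pow_sub_pow_le _ _ _).trans ?_
    calc _ ≤ r ^ 4 * j * Real.exp (-(r ^ 2 / 8)) ^ (j - 1) := by
          gcongr
          exact abs_besselZero_sub_exp_le h0 hr
      _ ≤ r ^ 4 * j * Real.exp (-(r ^ 2 / 8)) ^ (j - 1) * (2 * Real.exp (-(r ^ 2 / 8))) :=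
          le_mul_of_one_le_right (by positivity) (by linarith)
      _ = _ := by
          rw [hr']
          ring
  · rw [add_comm]
    refine (abs_sub _ _).trans (add_le_add ?_ ?_)
    · rw [abs_pow]
      exact abs_besselZero_pow_le_tail hρ0 hρ1 hρ hj hx hr
    · rw [abs_of_pos (Real.exp_pos _)]
      have h1 : 1 ≤ (2 * Real.pi * x) ^ 4 := one_le_pow₀ hr
      have h2 : Real.exp (-(j * Real.pi ^ 2) * x ^ 2) ≤
          Real.exp (-(j * (Real.pi ^ 2 / 2)) * x ^ 2) := by
        rw [Real.exp_le_exp]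
        have : 0 ≤ (j : ℝ) * (Real.pi ^ 2 / 2) * x ^ 2 := by positivity
        linarith
      have h3 : 1 ≤ 2 * j * (2 * Real.pi * x) ^ 4 := by nlinarith
      calc _ ≤ Real.exp (-(j * (Real.pi ^ 2 / 2)) * x ^ 2) := h2
        _ ≤ (2 * j * (2 * Real.pi * x) ^ 4) * Real.exp (-(j * (Real.pi ^ 2 / 2)) * x ^ 2) :=
          le_mul_of_one_le_left (Real.exp_pos _).le h3
        _ = _ := by ring

theorem integral_exp_neg_nat_mul_pi_sq {j : ℕ} (hj : 1 ≤ j) :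
    ∫ w : Plane, Real.exp (-(j * Real.pi ^ 2) * ‖w‖ ^ 2) = 1 / (Real.pi * j) := by
  have hpi := Real.pi_pos
  have hj0 : (0 : ℝ) < j := by exact_mod_cast hj
  rw [GaussianFourier.integral_rexp_neg_mul_sq_norm (by positivity), finrank_euclideanSpace_fin]
  simp
  field_simp

theorem summable_sqrt_pow_three_inv : Summable fun j : ℕ => ((√(j : ℝ)) ^ 3)⁻¹ := by
  refine (Real.summable_nat_rpow_inv (p := 3 / 2)).2 (by norm_num) |>.congr fun j => ?_
  rw [Real.sqrt_eq_rpow, ← Real.rpow_natCast, ← Real.rpow_mul (Nat.cast_nonneg _)]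
  norm_num

/-! ### The local limit estimate -/

section LocalLimit

open scoped FourierTransform

/-- A local limit estimate: probability measures whose characteristic function is the `j`-th power
of that of the uniform distribution on the unit circle give to bounded sets the mass
`volume Q / (π j)`, up to a summable error. -/
theorem exists_summable_abs_measureReal_sub_le :
    ∃ e : ℕ → ℝ, Summable e ∧ (∀ j, 0 ≤ e j) ∧ ∀ j : ℕ, 1 ≤ j → ∀ (ν : Measure Plane)
      [IsProbabilityMeasure ν], (∀ t, charFun ν t = (besselZero ‖t‖ : ℂ) ^ j) →
      ∀ Q : Set Plane, MeasurableSet Q → (∀ x ∈ Q, ‖x‖ ≤ 2) → volume Q ≤ 1 →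
      ν (frontier Q) = 0 → |ν.real Q - volume.real Q / (Real.pi * j)| ≤ e j := by
  obtain ⟨ρ, hρ0, hρ1, hρ⟩ := exists_abs_besselZero_le
  have hpi := Real.pi_gt_three
  set c : ℝ := Real.pi ^ 2 / 2 with hc
  have hc0 : 0 < c := by positivity
  set I₁ := ∫ w : Plane, ‖w‖ ^ 1 * Real.exp (-c * ‖w‖ ^ 2) with hI₁
  set I₄ := ∫ w : Plane, ‖w‖ ^ 4 * Real.exp (-c * ‖w‖ ^ 2) with hI₄
  set T₁ := ∫ w : Plane, ‖w‖ * ((1 + ‖w‖) ^ 4)⁻¹ with hT₁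
  set T₀ := ∫ w : Plane, ((1 + ‖w‖) ^ 4)⁻¹ with hT₀
  have hI₁0 : 0 ≤ I₁ := integral_nonneg fun w => by positivity
  have hI₄0 : 0 ≤ I₄ := integral_nonneg fun w => by positivity
  have hT₁0 : 0 ≤ T₁ := integral_nonneg fun w => by positivity
  have hT₀0 : 0 ≤ T₀ := integral_nonneg fun w => by positivity
  set K := 16 * (10 / ρ) ^ 12 with hK
  set A := 2 * Real.pi * 2 * I₁ + 2 * (2 * Real.pi) ^ 4 * I₄ with hA
  set B := 2 * Real.pi * 2 * K * T₁ + K * T₀ with hB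
  have hA0 : 0 ≤ A := by positivity
  have hB0 : 0 ≤ B := by positivity
  -- `A` collects the Gaussian errors and `B` the tails. The term 2/ρ¹² makes the bound at least 2,
  -- hence trivial, for j ≤ 12, where the tail estimate is not applied.
  refine ⟨fun j => A * ((√(j : ℝ)) ^ 3)⁻¹ + (B + 2 / ρ ^ 12) * ρ ^ j,
    (summable_sqrt_pow_three_inv.mul_left _).add
      ((summable_geometric_of_lt_one hρ0.le hρ1).mul_left _), fun j => by positivity, ?_⟩
  intro j hj ν _ hν Q hQ hQ2 hQ1 hfr
  have hv1 : volume.real Q ≤ 1 := by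
    simpa [measureReal_def] using ENNReal.toReal_mono ENNReal.one_ne_top hQ1
  have hv0 : 0 ≤ volume.real Q := measureReal_nonneg
  have hvt : volume Q ≠ ⊤ := ne_top_of_le_ne_top ENNReal.one_ne_top hQ1
  have hj0 : (1 : ℝ) ≤ j := by exact_mod_cast hj
  have hs0 : 0 < √(j : ℝ) := Real.sqrt_pos.2 (by linarith)
  rcases lt_or_ge j 13 with hj13 | hj13
  · have h1 : |ν.real Q - volume.real Q / (Real.pi * j)| ≤ 2 := by
      have h2 : volume.real Q / (Real.pi * j) ≤ 1 := by
        rw [div_le_one (by positivity)]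
        nlinarith
      have h3 : 0 ≤ volume.real Q / (Real.pi * j) := by positivity
      have h4 : ν.real Q ≤ 1 := measureReal_le_one
      have h5 : 0 ≤ ν.real Q := measureReal_nonneg
      rw [abs_le]
      constructor <;> linarith
    have h2 : ρ ^ 12 ≤ ρ ^ j := pow_le_pow_of_le_one hρ0.le hρ1.le (by omega)
    have h3 : 2 ≤ 2 / ρ ^ 12 * ρ ^ j := by
      rw [div_mul_eq_mul_div, le_div_iff₀ (by positivity)]
      linarith
    have h4 : 0 ≤ A * ((√(j : ℝ)) ^ 3)⁻¹ := by positivity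
    have h5 : 0 ≤ B * ρ ^ j := by positivity
    beta_reduce
    rw [add_mul]
    linarith
  set b : Plane → ℝ := fun w => besselZero (2 * Real.pi * ‖w‖) with hb
  have hcf : ∀ w, charFun ν ((2 * Real.pi) • w) = ((b w ^ j : ℝ) : ℂ) := by
    intro w
    rw [hν, norm_smul, Real.norm_of_nonneg (by positivity), Complex.ofReal_pow]
  -- Measurability is read off from the characteristic function of ν.
  have hbm : Measurable fun w => b w ^ j := by
    have h1 : Measurable fun w => (charFun ν ((2 * Real.pi) • w)).re :=
      Complex.measurable_re.comp (measurable_charFun.comp (measurable_const_smul _))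
    simpa only [hcf, Complex.ofReal_re] using h1
  have hg0 : Integrable fun w : Plane => Real.exp (-(j * c) * ‖w‖ ^ 2) := by
    simpa using integrable_norm_pow_mul_exp_nat hc0 0 hj
  have hg1 := integrable_norm_pow_mul_exp_nat hc0 1 hj
  have hg4 := integrable_norm_pow_mul_exp_nat hc0 4 hj
  have ht0 := integrable_one_add_norm_pow_inv (k := 4) (by norm_num)
  have ht1 := integrable_norm_mul_one_add_norm_pow_inv
  have hbabs : ∀ w, |b w ^ j| ≤ Real.exp (-(j * c) * ‖w‖ ^ 2) + K * ρ ^ j * ((1 + ‖w‖) ^ 4)⁻¹ := by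
    intro w
    rw [abs_pow]
    exact abs_besselZero_pow_le_add hρ0 hρ1 hρ hj13 (norm_nonneg w)
  have hbi : Integrable fun w => b w ^ j :=
    (hg0.add (ht0.const_mul (K * ρ ^ j))).mono' hbm.aestronglyMeasurable
      (Filter.Eventually.of_forall hbabs)
  have hbC : Integrable fun w => ((b w ^ j : ℝ) : ℂ) := hbi.ofReal
  have hinv := measureReal_eq_integral_charFun_mul_fourier hQ hvt hfr (ν := ν) (by
    simp_rw [hcf]
    exact hbC)
  simp_rw [hcf] at hinv
  set f : Plane → ℂ := 𝓕 (Q.indicator fun _ => (1 : ℂ)) with hf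
  have hfc : Continuous f := VectorFourier.fourierIntegral_continuous
    Real.continuous_fourierChar continuous_inner
    ((integrable_indicator_iff hQ).2 (integrableOn_const hvt))
  have hfb : ∀ w, ‖f w - (volume.real Q : ℂ)‖ ≤ 2 * Real.pi * 2 * ‖w‖ := by
    intro w
    refine (norm_fourier_indicator_sub_le hQ hvt hQ2 w).trans ?_
    exact mul_le_of_le_one_right (by positivity) hv1
  have hGi : Integrable fun w : Plane => Real.exp (-(j * Real.pi ^ 2) * ‖w‖ ^ 2) := by
    simpa using integrable_norm_pow_mul_exp_nat (by positivity : 0 < Real.pi ^ 2) 0 hj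
  have hX : Integrable fun w => ((b w ^ j : ℝ) : ℂ) * (f w - (volume.real Q : ℂ)) := by
    refine ((hg1.const_mul (2 * Real.pi * 2)).add
      (ht1.const_mul (2 * Real.pi * 2 * K * ρ ^ j))).mono' ?_ (Filter.Eventually.of_forall ?_)
    · exact (Complex.measurable_ofReal.comp hbm).aestronglyMeasurable.mul
        (hfc.sub continuous_const).aestronglyMeasurable
    · intro w
      rw [norm_mul, Complex.norm_real, Real.norm_eq_abs]
      refine (mul_le_mul (hbabs w) (hfb w) (norm_nonneg _) (by positivity)).trans (le_of_eq ?_)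
      simp only [Pi.add_apply]
      ring
  have hXle : ‖∫ w, ((b w ^ j : ℝ) : ℂ) * (f w - (volume.real Q : ℂ))‖ ≤
      2 * Real.pi * 2 * (((√(j : ℝ)) ^ 3)⁻¹ * I₁) + 2 * Real.pi * 2 * K * ρ ^ j * T₁ := by
    refine (norm_integral_le_of_norm_le ((hg1.const_mul (2 * Real.pi * 2)).add
      (ht1.const_mul (2 * Real.pi * 2 * K * ρ ^ j))) (Filter.Eventually.of_forall ?_)).trans
      (le_of_eq ?_)
    · intro w
      rw [norm_mul, Complex.norm_real, Real.norm_eq_abs]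
      refine (mul_le_mul (hbabs w) (hfb w) (norm_nonneg _) (by positivity)).trans (le_of_eq ?_)
      simp only [Pi.add_apply]
      ring
    · simp only [Pi.add_apply]
      rw [integral_add (hg1.const_mul _) (ht1.const_mul _), integral_const_mul,
        integral_const_mul, integral_norm_pow_mul_exp_nat c 1 hj]
  have hYle : |∫ w, (b w ^ j - Real.exp (-(j * Real.pi ^ 2) * ‖w‖ ^ 2))| ≤
      2 * (2 * Real.pi) ^ 4 * j * (((√(j : ℝ)) ^ 6)⁻¹ * I₄) + K * ρ ^ j * T₀ := by
    rw [← Real.norm_eq_abs]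
    refine (norm_integral_le_of_norm_le ((hg4.const_mul (2 * (2 * Real.pi) ^ 4 * j)).add
      (ht0.const_mul (K * ρ ^ j))) (Filter.Eventually.of_forall ?_)).trans (le_of_eq ?_)
    · intro w
      exact abs_besselZero_pow_sub_exp_le hρ0 hρ1 hρ hj13 (norm_nonneg w)
    · simp only [Pi.add_apply]
      rw [integral_add (hg4.const_mul _) (ht0.const_mul _), integral_const_mul,
        integral_const_mul, integral_norm_pow_mul_exp_nat c 4 hj]
  -- Two replacements: the transform of the indicator by its value at 0, which costs a factor
  -- O(‖w‖), and the power of J₀ by a Gaussian of total integral 1/(πj).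
  have hsplit : ((ν.real Q - volume.real Q / (Real.pi * j) : ℝ) : ℂ) =
      (∫ w, ((b w ^ j : ℝ) : ℂ) * (f w - (volume.real Q : ℂ))) +
      ((volume.real Q * ∫ w, (b w ^ j - Real.exp (-(j * Real.pi ^ 2) * ‖w‖ ^ 2)) : ℝ) : ℂ) := by
    have e1 : ∫ w, ((b w ^ j : ℝ) : ℂ) * f w =
        (∫ w, ((b w ^ j : ℝ) : ℂ) * (f w - (volume.real Q : ℂ))) +
          ((volume.real Q * ∫ w, b w ^ j : ℝ) : ℂ) := by
      rw [Complex.ofReal_mul, ← integral_complex_ofReal, ← integral_const_mul,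
        ← integral_add hX (hbC.const_mul _)]
      congr 1
      ext w
      ring
    rw [integral_sub hbi hGi, integral_exp_neg_nat_mul_pi_sq hj, Complex.ofReal_sub, hinv, e1,
      mul_sub, Complex.ofReal_sub]
    rw [mul_one_div]
    ring
  rw [← Real.norm_eq_abs, ← Complex.norm_real, hsplit]
  refine (norm_add_le _ _).trans ?_
  have hY2 : ‖((volume.real Q * ∫ w, (b w ^ j - Real.exp (-(j * Real.pi ^ 2) * ‖w‖ ^ 2)) : ℝ) : ℂ)‖
      ≤ 2 * (2 * Real.pi) ^ 4 * j * (((√(j : ℝ)) ^ 6)⁻¹ * I₄) + K * ρ ^ j * T₀ := by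
    rw [Complex.norm_real, Real.norm_eq_abs, abs_mul, abs_of_nonneg hv0]
    exact (mul_le_of_le_one_left (abs_nonneg _) hv1).trans hYle
  have hsq : (j : ℝ) = √(j : ℝ) ^ 2 := (Real.sq_sqrt (by linarith)).symm
  have hs1 : 1 ≤ √(j : ℝ) := Real.one_le_sqrt.2 hj0
  -- The Gaussian comparison errs by j⁻², which is weakened to the j^(-3/2) of the other
  -- replacement.
  have hpow : (j : ℝ) * ((√(j : ℝ)) ^ 6)⁻¹ ≤ ((√(j : ℝ)) ^ 3)⁻¹ := by
    have : (j : ℝ) * ((√(j : ℝ)) ^ 6)⁻¹ = ((√(j : ℝ)) ^ 4)⁻¹ := by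
      nth_rewrite 1 [hsq]
      field_simp
    rw [this]
    exact inv_anti₀ (by positivity) (pow_le_pow_right₀ hs1 (by norm_num))
  have hY3 : 2 * (2 * Real.pi) ^ 4 * j * (((√(j : ℝ)) ^ 6)⁻¹ * I₄) ≤
      2 * (2 * Real.pi) ^ 4 * I₄ * ((√(j : ℝ)) ^ 3)⁻¹ := by
    have := mul_le_mul_of_nonneg_left hpow (by positivity : 0 ≤ 2 * (2 * Real.pi) ^ 4 * I₄)
    linarith
  have hρj : 0 ≤ 2 / ρ ^ 12 * ρ ^ j := by positivity
  have := add_le_add hXle hY2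
  rw [hA, hB]
  linarith

end LocalLimit

/-! ### The crossing parallelogram -/

/-- The vectors `x` for which a segment with direction `u` and a segment with direction `v` meet at
an interior point of each of them, when `x` leads from the end of the first segment to the start of
the second one. -/
def crossingSet (u v : Plane) : Set Plane :=
  {x | (-1 < planeDet x v / planeDet u v ∧ planeDet x v / planeDet u v < 0) ∧
    (-1 < planeDet u x / planeDet u v ∧ planeDet u x / planeDet u v < 0)}

theorem measurableSet_crossingSet_prod :
    MeasurableSet {p : (Plane × Plane) × Plane | p.2 ∈ crossingSet p.1.1 p.1.2} := by
  have h1 : Measurable fun p : (Plane × Plane) × Plane =>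
      planeDet p.2 p.1.2 / planeDet p.1.1 p.1.2 := by
    unfold planeDet
    fun_prop
  have h2 : Measurable fun p : (Plane × Plane) × Plane =>
      planeDet p.1.1 p.2 / planeDet p.1.1 p.1.2 := by
    unfold planeDet
    fun_prop
  exact ((measurableSet_lt measurable_const h1).inter (measurableSet_lt h1 measurable_const)).inter
    ((measurableSet_lt measurable_const h2).inter (measurableSet_lt h2 measurable_const))

theorem continuous_planeDet_left (v : Plane) : Continuous fun x => planeDet x v :=
  continuous_planeDet.comp (Continuous.prodMk_left v)

theorem continuous_planeDet_right (u : Plane) : Continuous fun x => planeDet u x :=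
  continuous_planeDet.comp (Continuous.prodMk_right u)

theorem isOpen_crossingSet (u v : Plane) : IsOpen (crossingSet u v) := by
  have h1 := (continuous_planeDet_left v).div_const (planeDet u v)
  have h2 := (continuous_planeDet_right u).div_const (planeDet u v)
  exact ((isOpen_lt continuous_const h1).inter (isOpen_lt h1 continuous_const)).inter
    ((isOpen_lt continuous_const h2).inter (isOpen_lt h2 continuous_const))

/-- Division by zero gives 0, which fails the strict inequality < 0. -/
theorem crossingSet_eq_empty {u v : Plane} (h : planeDet u v = 0) : crossingSet u v = ∅ := by
  ext x
  simp [crossingSet, h]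

/-- Cramer's rule: the quotients defining `crossingSet` are the coordinates in the basis u, v. -/
theorem eq_smul_add_smul_of_planeDet_ne_zero {u v : Plane} (h : planeDet u v ≠ 0) (x : Plane) :
    x = (planeDet x v / planeDet u v) • u + (planeDet u x / planeDet u v) • v := by
  ext i
  fin_cases i
  · simp
    field_simp
    simp [planeDet]
    ring
  · simp
    field_simp
    simp [planeDet]
    ring

theorem norm_le_of_mem_crossingSet {u v x : Plane} (hu : ‖u‖ = 1) (hv : ‖v‖ = 1)
    (hx : x ∈ crossingSet u v) : ‖x‖ ≤ 2 := by
  by_cases h : planeDet u v = 0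
  · rw [crossingSet_eq_empty h] at hx
    exact hx.elim
  · rw [eq_smul_add_smul_of_planeDet_ne_zero h x]
    obtain ⟨⟨h1, h2⟩, h3, h4⟩ := hx
    refine (norm_add_le _ _).trans ?_
    rw [norm_smul, norm_smul, hu, hv, Real.norm_eq_abs, Real.norm_eq_abs, abs_of_neg h2,
      abs_of_neg h4]
    linarith

/-- In these coordinates the set is the preimage of the square (-1, 0)² under a linear map of
determinant 1/det(u, v). -/
theorem volume_crossingSet (u v : Plane) :
    volume (crossingSet u v) = ENNReal.ofReal |planeDet u v| := by
  by_cases h : planeDet u v = 0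
  · simp [crossingSet_eq_empty h, h]
  set D := planeDet u v with hD
  set M : Matrix (Fin 2) (Fin 2) ℝ := !![v 1 / D, -v 0 / D; -u 1 / D, u 0 / D] with hM
  have hdet : M.det = D⁻¹ := by
    rw [hM, Matrix.det_fin_two_of]
    have : u 0 * v 1 - u 1 * v 0 = D := rfl
    field_simp
    linarith
  have hpre : (WithLp.toLp 2) ⁻¹' (crossingSet u v) =
      (Matrix.toLin' M) ⁻¹' (Set.univ.pi fun _ => Set.Ioo (-1 : ℝ) 0) := by
    ext x
    have e0 : M.mulVec x 0 = planeDet (WithLp.toLp 2 x) v / D := by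
      simp [hM, Matrix.mulVec, dotProduct, Fin.sum_univ_two, planeDet]
      ring
    have e1 : M.mulVec x 1 = planeDet u (WithLp.toLp 2 x) / D := by
      simp [hM, Matrix.mulVec, dotProduct, Fin.sum_univ_two, planeDet]
      ring
    simp only [Set.mem_preimage, Set.mem_univ_pi, Fin.forall_fin_two, Matrix.toLin'_apply, e0, e1,
      Set.mem_Ioo]
    rfl
  rw [← (PiLp.volume_preserving_toLp (Fin 2)).measure_preimage
    (isOpen_crossingSet u v).measurableSet.nullMeasurableSet, hpre,
    Measure.addHaar_preimage_linearMap, Real.volume_pi_Ioo]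
  · simp [LinearMap.det_toLin', hdet]
  · rw [LinearMap.det_toLin', hdet]
    exact inv_ne_zero h

theorem planeDet_eq_inner_left (x v : Plane) : planeDet x v = inner ℝ x !₂[v 1, -v 0] := by
  simp [planeDet, PiLp.inner_apply, Fin.sum_univ_two]
  ring

theorem planeDet_eq_inner_right (u x : Plane) : planeDet u x = inner ℝ x !₂[-u 1, u 0] := by
  simp [planeDet, PiLp.inner_apply, Fin.sum_univ_two]
  ring

theorem measure_setOf_planeDet_left_eq {ν : Measure Plane}
    (hν : ∀ a : Plane, a ≠ 0 → ∀ c, ν {x | inner ℝ x a = c} = 0) {v : Plane} (hv : v ≠ 0) (c : ℝ) :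
    ν {x | planeDet x v = c} = 0 := by
  simp_rw [planeDet_eq_inner_left]
  refine hν _ (fun h => hv ?_) c
  have h0 := congrArg (fun y : Plane => y 0) h
  have h1 := congrArg (fun y : Plane => y 1) h
  ext i
  fin_cases i
  · simpa using h1
  · simpa using h0

theorem measure_setOf_planeDet_right_eq {ν : Measure Plane}
    (hν : ∀ a : Plane, a ≠ 0 → ∀ c, ν {x | inner ℝ x a = c} = 0) {u : Plane} (hu : u ≠ 0) (c : ℝ) :
    ν {x | planeDet u x = c} = 0 := by
  simp_rw [planeDet_eq_inner_right]
  refine hν _ (fun h => hu ?_) c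
  have h0 := congrArg (fun y : Plane => y 0) h
  have h1 := congrArg (fun y : Plane => y 1) h
  ext i
  fin_cases i
  · simpa using h1
  · simpa using h0

/-- The frontier lies on the four lines carrying the sides, each of them null by hypothesis. -/
theorem measure_frontier_crossingSet {ν : Measure Plane}
    (hν : ∀ a : Plane, a ≠ 0 → ∀ c, ν {x | inner ℝ x a = c} = 0) {u v : Plane} (hu : u ≠ 0)
    (hv : v ≠ 0) : ν (frontier (crossingSet u v)) = 0 := by
  by_cases h : planeDet u v = 0
  · simp [crossingSet_eq_empty h]
  set D := planeDet u v with hD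
  have h1 := (continuous_planeDet_left v).div_const D
  have h2 := (continuous_planeDet_right u).div_const D
  let R : Set Plane := {x | (-1 ≤ planeDet x v / D ∧ planeDet x v / D ≤ 0) ∧
    (-1 ≤ planeDet u x / D ∧ planeDet u x / D ≤ 0)}
  have hcl : IsClosed R :=
    ((isClosed_le continuous_const h1).inter (isClosed_le h1 continuous_const)).inter
      ((isClosed_le continuous_const h2).inter (isClosed_le h2 continuous_const))
  have hsub : closure (crossingSet u v) ⊆ R := closure_minimal
    (fun x hx => ⟨⟨hx.1.1.le, hx.1.2.le⟩, hx.2.1.le, hx.2.2.le⟩) hcl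
  refine measure_mono_null (t := ({x | planeDet x v = -D} ∪ {x | planeDet x v = 0}) ∪
    ({x | planeDet u x = -D} ∪ {x | planeDet u x = 0})) ?_ ?_
  · rintro x ⟨hx1, hx2⟩
    rw [(isOpen_crossingSet u v).interior_eq] at hx2
    obtain ⟨⟨a1, a2⟩, a3, a4⟩ := hsub hx1
    by_contra hcon
    simp only [Set.mem_union, Set.mem_ofPred_eq, not_or] at hcon
    obtain ⟨⟨b1, b2⟩, b3, b4⟩ := hcon
    refine hx2 ⟨⟨lt_of_le_of_ne a1 fun hh => b1 ?_, lt_of_le_of_ne a2 fun hh => b2 ?_⟩,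
      lt_of_le_of_ne a3 fun hh => b3 ?_, lt_of_le_of_ne a4 fun hh => b4 ?_⟩
    · rw [eq_div_iff h] at hh
      linarith
    · rw [div_eq_iff h] at hh
      linarith
    · rw [eq_div_iff h] at hh
      linarith
    · rw [div_eq_iff h] at hh
      linarith
  · refine measure_union_null (measure_union_null ?_ ?_) (measure_union_null ?_ ?_)
    · exact measure_setOf_planeDet_left_eq hν hv _
    · exact measure_setOf_planeDet_left_eq hν hv _
    · exact measure_setOf_planeDet_right_eq hν hu _
    · exact measure_setOf_planeDet_right_eq hν hu _

/-- The equation a + s(b - a) = c + t(d - c) rearranges to c - b = -(1 - s)(b - a) - t(d - c), and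
coordinates in a basis are unique. -/
theorem openSegment_inter_nonempty_iff {a b c d : Plane} (h : planeDet (b - a) (d - c) ≠ 0) :
    (openSegment ℝ a b ∩ openSegment ℝ c d).Nonempty ↔
      c - b ∈ crossingSet (b - a) (d - c) := by
  rw [openSegment_eq_image', openSegment_eq_image']
  constructor
  · rintro ⟨_, ⟨s, hs, rfl⟩, t, ht, hst⟩
    simp only at hst
    have e : c - b = -(1 - s) • (b - a) + -t • (d - c) := by
      have : c = a + s • (b - a) - t • (d - c) := by rw [← hst]; abel
      calc c - b = a + s • (b - a) - t • (d - c) - b := by rw [← this]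
        _ = _ := by module
    have e1 : planeDet (c - b) (d - c) / planeDet (b - a) (d - c) = -(1 - s) := by
      rw [div_eq_iff h, e]
      simp [planeDet]
      ring
    have e2 : planeDet (b - a) (c - b) / planeDet (b - a) (d - c) = -t := by
      rw [div_eq_iff h, e]
      simp [planeDet]
      ring
    refine ⟨⟨?_, ?_⟩, ?_, ?_⟩
    · rw [e1]; linarith [hs.1]
    · rw [e1]; linarith [hs.2]
    · rw [e2]; linarith [ht.2]
    · rw [e2]; linarith [ht.1]
  · rintro ⟨⟨h1, h2⟩, h3, h4⟩
    have e := eq_smul_add_smul_of_planeDet_ne_zero h (c - b)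
    set α := planeDet (c - b) (d - c) / planeDet (b - a) (d - c)
    set β := planeDet (b - a) (c - b) / planeDet (b - a) (d - c)
    refine ⟨a + (1 + α) • (b - a), ⟨1 + α, ⟨by linarith, by linarith⟩, rfl⟩, -β,
      ⟨by linarith, by linarith⟩, ?_⟩
    simp only
    calc c + -β • (d - c) = (c - b) + b - β • (d - c) := by module
      _ = α • (b - a) + β • (d - c) + b - β • (d - c) := by rw [← e]
      _ = _ := by module

/-! ### Independent steps and the probability of one crossing -/

section Independence

variable {Ω ι : Type*} [MeasurableSpace Ω] {P : Measure Ω}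
  {Y : ι → Ω → Plane}

theorem charFun_map_sum_unit_steps (hY : iIndepFun Y P)
    (hlaw : ∀ i, HasLaw (Y i) uniformUnitCircle P) (s : Finset ι) (t : Plane) :
    charFun (P.map fun ω => ∑ i ∈ s, Y i ω) t = (besselZero ‖t‖ : ℂ) ^ s.card := by
  have h : iIndepFun (s.restrict Y) P := hY.restrict s
  rw [h.charFun_map_fun_finsetSum_eq_prod (fun i _ => (hlaw i).aemeasurable), Finset.prod_apply]
  simp_rw [(hlaw _).map_eq, charFun_uniformUnitCircle]
  rw [Finset.prod_const]

variable [IsProbabilityMeasure P]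

/-- One step is split off; given the others, it would have to lie on a fixed line. -/
theorem map_sum_unit_steps_line (hY : iIndepFun Y P)
    (hlaw : ∀ i, HasLaw (Y i) uniformUnitCircle P) {s : Finset ι} (hs : s.Nonempty)
    (a : Plane) (ha : a ≠ 0) (c : ℝ) :
    P.map (fun ω => ∑ i ∈ s, Y i ω) {x | inner ℝ x a = c} = 0 := by
  classical
  obtain ⟨i₀, hi₀⟩ := hs
  have hm : ∀ i, AEMeasurable (Y i) P := fun i => (hlaw i).aemeasurable
  have hind := hY.indepFun_finsetSum_of_notMem₀ hm (Finset.notMem_erase i₀ s)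
  have hms : AEMeasurable (∑ i ∈ s.erase i₀, Y i) P := Finset.aemeasurable_sum _ fun i _ => hm i
  have heq : (fun ω => ∑ i ∈ s, Y i ω) =
      (fun p : Plane × Plane => p.1 + p.2) ∘ fun ω => ((∑ i ∈ s.erase i₀, Y i) ω, Y i₀ ω) := by
    ext1 ω
    simp [Finset.sum_apply, Finset.sum_erase_add s _ hi₀]
  have hset : MeasurableSet {x : Plane | inner ℝ x a = c} :=
    measurableSet_eq_fun (by fun_prop) measurable_const
  rw [heq, ← AEMeasurable.map_map_of_aemeasurable (by fun_prop) (hms.prodMk (hm i₀)),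
    (indepFun_iff_map_prod_eq_prod_map_map hms (hm i₀)).1 hind, (hlaw i₀).map_eq,
    Measure.map_apply measurable_add hset, Measure.measure_prod_null (measurable_add hset)]
  refine Filter.Eventually.of_forall fun r => ?_
  have h1 : Prod.mk r ⁻¹' ((fun p : Plane × Plane => p.1 + p.2) ⁻¹' {x | inner ℝ x a = c}) =
      {x | inner ℝ x a = c - inner ℝ r a} := by
    ext x
    simp only [Set.mem_preimage, Set.mem_ofPred_eq, inner_add_left]
    constructor <;> intro h <;> linarith
  change uniformUnitCircle (Prod.mk r ⁻¹' _) = 0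
  rw [h1]
  exact uniformUnitCircle_line ha _

theorem map_prodMk_sum_unit_steps (hY : iIndepFun Y P)
    (hlaw : ∀ i, HasLaw (Y i) uniformUnitCircle P) {s : Finset ι} {k l : ι} (hkl : k ≠ l)
    (hk : k ∉ s) (hl : l ∉ s) :
    P.map (fun ω => ((Y k ω, Y l ω), ∑ i ∈ s, Y i ω)) =
      (uniformUnitCircle.prod uniformUnitCircle).prod (P.map fun ω => ∑ i ∈ s, Y i ω) := by
  classical
  have hm : ∀ i, AEMeasurable (Y i) P := fun i => (hlaw i).aemeasurable
  have hdisj : Disjoint ({k, l} : Finset ι) s := by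
    rw [Finset.disjoint_left]
    intro i hi
    rcases Finset.mem_insert.1 hi with rfl | hi
    · exact hk
    · rw [Finset.mem_singleton.1 hi]
      exact hl
  have h1 := hY.indepFun_finset₀ _ _ hdisj hm
  have h2 := h1.comp
    (φ := fun a : ({k, l} : Finset ι) → Plane => (a ⟨k, by simp⟩, a ⟨l, by simp⟩))
    (ψ := fun a : s → Plane => ∑ i : s, a i) (by fun_prop) (by fun_prop)
  have e2 : ((fun a : s → Plane => ∑ i : s, a i) ∘ fun ω (i : s) => Y i ω) =
      fun ω => ∑ i ∈ s, Y i ω := by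
    ext1 ω
    exact Finset.sum_coe_sort s fun i => Y i ω
  rw [e2] at h2
  have h3 := (indepFun_iff_map_prod_eq_prod_map_map ((hm k).prodMk (hm l))
    (Finset.aemeasurable_fun_sum s fun i _ => hm i)).1 h2
  have h4 := (indepFun_iff_map_prod_eq_prod_map_map (hm k) (hm l)).1 (hY.indepFun hkl)
  rw [(hlaw k).map_eq, (hlaw l).map_eq] at h4
  rw [← h4]
  exact h3

theorem ae_planeDet_ne_zero :
    ∀ᵐ p ∂(uniformUnitCircle.prod uniformUnitCircle), planeDet p.1 p.2 ≠ 0 := by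
  have hm : MeasurableSet {p : Plane × Plane | planeDet p.1 p.2 = 0} :=
    continuous_planeDet.measurable (measurableSet_singleton 0)
  refine measure_eq_zero_iff_ae_notMem.1 ((Measure.measure_prod_null hm).2 ?_)
  filter_upwards [ae_norm_eq_one_uniformUnitCircle] with u hu
  refine measure_setOf_planeDet_right_eq (fun a ha c => uniformUnitCircle_line ha c) ?_ 0
  rintro rfl
  simp at hu

/-- Fubini over the two directions: the local limit estimate holds on almost every fibre with an
error not depending on u and v, and averaging |det(u, v)|/(πj) yields the constant 2/π². -/
theorem abs_measureReal_sum_mem_crossingSet_sub_le {e : ℕ → ℝ}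
    (he : ∀ j : ℕ, 1 ≤ j → ∀ (ν : Measure Plane)
      [IsProbabilityMeasure ν], (∀ t, charFun ν t = (besselZero ‖t‖ : ℂ) ^ j) →
      ∀ Q : Set Plane, MeasurableSet Q → (∀ x ∈ Q, ‖x‖ ≤ 2) → volume Q ≤ 1 →
      ν (frontier Q) = 0 → |ν.real Q - volume.real Q / (Real.pi * j)| ≤ e j)
    (hY : iIndepFun Y P)
    (hlaw : ∀ i, HasLaw (Y i) uniformUnitCircle P) {s : Finset ι} (hs : s.Nonempty)
    {k l : ι} (hkl : k ≠ l) (hk : k ∉ s) (hl : l ∉ s) :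
    |P.real {ω | ∑ i ∈ s, Y i ω ∈ crossingSet (Y k ω) (Y l ω)} -
      2 / Real.pi ^ 2 * (1 / s.card)| ≤ e s.card := by
  have hm : ∀ i, AEMeasurable (Y i) P := fun i => (hlaw i).aemeasurable
  have hms : AEMeasurable (fun ω => ∑ i ∈ s, Y i ω) P :=
    Finset.aemeasurable_fun_sum s fun i _ => hm i
  set ν := P.map fun ω => ∑ i ∈ s, Y i ω with hν
  have hνP : IsProbabilityMeasure ν := Measure.isProbabilityMeasure_map hms
  set A := {p : (Plane × Plane) × Plane | p.2 ∈ crossingSet p.1.1 p.1.2} with hA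
  have hAm : MeasurableSet A := measurableSet_crossingSet_prod
  set ξ := uniformUnitCircle.prod uniformUnitCircle with hξ
  have e1 : P.real {ω | ∑ i ∈ s, Y i ω ∈ crossingSet (Y k ω) (Y l ω)} = (ξ.prod ν).real A := by
    rw [hξ, hν, ← map_prodMk_sum_unit_steps hY hlaw hkl hk hl, measureReal_def, measureReal_def,
      Measure.map_apply_of_aemeasurable (((hm k).prodMk (hm l)).prodMk hms) hAm]
    rfl
  have e2 : (ξ.prod ν).real A = ∫ p, ν.real (crossingSet p.1 p.2) ∂ξ := by
    rw [measureReal_def, Measure.prod_apply hAm, ← integral_toReal]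
    · rfl
    · exact (measurable_measure_prodMk_left hAm).aemeasurable
    · exact Filter.Eventually.of_forall fun p => measure_lt_top _ _
  have hnu := ae_norm_eq_one_uniformUnitCircle
  have hint1 : Integrable (fun p : Plane × Plane => ν.real (crossingSet p.1 p.2)) ξ := by
    refine (integrable_const (1 : ℝ)).mono'
      ((measurable_measure_prodMk_left hAm).ennreal_toReal).aestronglyMeasurable
      (Filter.Eventually.of_forall fun p => ?_)
    rw [Real.norm_of_nonneg measureReal_nonneg]
    exact measureReal_le_one
  have hae1 : ∀ᵐ p ∂ξ, ‖p.1‖ = 1 := Measure.quasiMeasurePreserving_fst.ae hnu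
  have hae2 : ∀ᵐ p ∂ξ, ‖p.2‖ = 1 := Measure.quasiMeasurePreserving_snd.ae hnu
  have hint2 : Integrable (fun p : Plane × Plane => |planeDet p.1 p.2|) ξ := by
    refine (integrable_const (1 : ℝ)).mono' continuous_planeDet.abs.aestronglyMeasurable ?_
    filter_upwards [hae1, hae2] with p h1 h2
    have := abs_planeDet_le p.1 p.2
    rw [h1, h2] at this
    simpa using this
  have e3 : 2 / Real.pi ^ 2 * (1 / s.card) =
      ∫ p, |planeDet p.1 p.2| / (Real.pi * s.card) ∂ξ := by
    rw [integral_div, hξ, integral_abs_planeDet]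
    have := Real.pi_pos
    field_simp
  rw [e1, e2, e3, ← integral_sub hint1 (hint2.div_const _), ← Real.norm_eq_abs]
  have hle : ∀ᵐ p ∂ξ, ‖ν.real (crossingSet p.1 p.2) -
      |planeDet p.1 p.2| / (Real.pi * s.card)‖ ≤ e s.card := by
    filter_upwards [hae1, hae2] with p h1 h2
    have hvol := volume_crossingSet p.1 p.2
    have hD : |planeDet p.1 p.2| ≤ 1 := by
      have := abs_planeDet_le p.1 p.2
      rwa [h1, h2, one_mul] at this
    have h := he s.card hs.card_pos ν (charFun_map_sum_unit_steps hY hlaw s)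
      (crossingSet p.1 p.2) (isOpen_crossingSet _ _).measurableSet
      (fun x hx => norm_le_of_mem_crossingSet h1 h2 hx)
      (by rw [hvol]; exact ENNReal.ofReal_le_one.2 hD)
      (measure_frontier_crossingSet (map_sum_unit_steps_line hY hlaw hs)
        (norm_ne_zero_iff.1 (by rw [h1]; exact one_ne_zero))
        (norm_ne_zero_iff.1 (by rw [h2]; exact one_ne_zero)))
    rw [measureReal_def volume, hvol, ENNReal.toReal_ofReal (abs_nonneg _)] at h
    exact h
  refine (norm_integral_le_of_norm_le_const hle).trans (le_of_eq ?_)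
  simp

end Independence

/-! ### Telescoping, counting and harmonic sums -/

theorem sum_Ioo_sub_eq {n : ℕ} (x : Fin (n + 1) → Plane) {k l : Fin n} (hkl : k < l) :
    ∑ i ∈ Finset.Ioo k l, (x i.succ - x i.castSucc) = x l.castSucc - x k.succ := by
  -- Extension to ℕ for telescoping over natural numbers; the value 0 beyond n is never used.
  let y : ℕ → Plane := fun m => if h : m < n + 1 then x ⟨m, h⟩ else 0
  have h1 : ∀ i : Fin n, x i.succ = y (i + 1) := fun i => by
    simp only [y]
    rw [dif_pos (by omega)]
    rfl
  have h2 : ∀ i : Fin n, x i.castSucc = y i := fun i => by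
    simp only [y]
    rw [dif_pos (by omega)]
    rfl
  have h3 := Finset.sum_map (Finset.Ioo k l) Fin.valEmbedding fun m => y (m + 1) - y m
  rw [Fin.map_valEmbedding_Ioo] at h3
  simp only [h1, h2]
  simp only [Fin.valEmbedding_apply] at h3
  rw [← h3]
  have h4 : Finset.Ioo (k : ℕ) l = Finset.Ico (k + 1 : ℕ) l := by
    ext m
    simp only [Finset.mem_Ioo, Finset.mem_Ico]
    omega
  rw [h4]
  exact Finset.sum_Ico_sub y (by exact_mod_cast hkl)

/-- The pairs of indices of segments that are at distance at least two. -/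
def distantPairs (n : ℕ) : Finset (Fin n × Fin n) :=
  Finset.univ.filter fun p => (p.1 : ℕ) + 2 ≤ (p.2 : ℕ)

/-- The segments with indices `k` and `l` of the path through `x 0, …, x n` meet at an interior
point of each of them. -/
def SegmentsCross {n : ℕ} (x : Fin (n + 1) → Plane) (k l : Fin n) : Prop :=
  (openSegment ℝ (x k.castSucc) (x k.succ) ∩ openSegment ℝ (x l.castSucc) (x l.succ)).Nonempty

theorem selfIntersections_eq_sum {Ω : Type*} {n : ℕ} (X : Fin (n + 1) → Ω → Plane) (ω : Ω) :
    (selfIntersections (fun k => X k ω) : ℝ) =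
      ∑ p ∈ distantPairs n,
        {ω | SegmentsCross (fun k => X k ω) p.1 p.2}.indicator (fun _ => (1 : ℝ)) ω := by
  classical
  have h : {p : Fin n × Fin n | (p.1 : ℕ) + 2 ≤ (p.2 : ℕ) ∧
      (openSegment ℝ (X p.1.castSucc ω) (X p.1.succ ω) ∩
        openSegment ℝ (X p.2.castSucc ω) (X p.2.succ ω)).Nonempty} =
      ((distantPairs n).filter fun p => SegmentsCross (fun k => X k ω) p.1 p.2 :
        Finset (Fin n × Fin n)) := by
    ext p
    rw [Finset.mem_coe, Finset.mem_filter, distantPairs, Finset.mem_filter]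
    simp [SegmentsCross]
  rw [selfIntersections, h, Set.ncard_coe_finset, Finset.card_filter]
  push_cast
  refine Finset.sum_congr rfl fun p _ => ?_
  simp [Set.indicator_apply]

/-- For fixed l, the number l - k - 1 of steps in between runs through 1, …, l - 1. -/
theorem sum_distantPairs (n : ℕ) (g : ℕ → ℝ) :
    ∑ p ∈ distantPairs n, g (p.2 - p.1 - 1) =
      ∑ l ∈ Finset.range n, ∑ j ∈ Finset.range (l - 1), g (j + 1) := by
  rw [distantPairs, Finset.sum_filter, ← Finset.univ_product_univ, Finset.sum_product_right,
    Fin.sum_univ_eq_sum_range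
      (fun l => ∑ k : Fin n, if (k : ℕ) + 2 ≤ l then g (l - k - 1) else 0) n]
  refine Finset.sum_congr rfl fun l hl => ?_
  rw [Fin.sum_univ_eq_sum_range (fun k => if k + 2 ≤ l then g (l - k - 1) else 0) n,
    ← Finset.sum_filter, ← Finset.sum_range_reflect]
  have h : (Finset.range n).filter (fun k => k + 2 ≤ l) = Finset.range (l - 1) := by
    ext k
    simp only [Finset.mem_filter, Finset.mem_range] at hl ⊢
    omega
  rw [h]
  refine Finset.sum_congr rfl fun k hk => ?_
  rw [Finset.mem_range] at hk
  congr 1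
  omega

theorem sum_range_harmonic (n : ℕ) :
    ∑ m ∈ Finset.range n, ((harmonic m : ℚ) : ℝ) = n * (harmonic n : ℚ) - n := by
  induction n with
  | zero => simp
  | succ n ih =>
    rw [Finset.sum_range_succ, ih, harmonic_succ]
    push_cast
    have : (n : ℝ) + 1 ≠ 0 := by positivity
    field_simp
    ring

theorem abs_sum_sum_inv_sub_le {n : ℕ} (hn : 1 ≤ n) :
    |∑ l ∈ Finset.range n, ∑ j ∈ Finset.range (l - 1), 1 / ((j + 1 : ℕ) : ℝ) -
      n * Real.log n| ≤ 2 * n := by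
  -- With n = m + 1, splitting off l = 0 removes the truncated subtraction and leaves the sum of the
  -- harmonic numbers below m.
  obtain ⟨m, rfl⟩ := Nat.exists_eq_add_of_le' hn
  have h1 : ∀ l, ∑ j ∈ Finset.range l, 1 / ((j + 1 : ℕ) : ℝ) = ((harmonic l : ℚ) : ℝ) := by
    intro l
    simp [harmonic]
  simp_rw [h1]
  rw [Finset.sum_range_succ']
  simp only [Nat.add_sub_cancel, zero_tsub, harmonic_zero, Rat.cast_zero, add_zero]
  rw [sum_range_harmonic]
  have h2 := log_add_one_le_harmonic m
  have h3 := harmonic_le_one_add_log m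
  have h4 : Real.log m ≤ Real.log ((m + 1 : ℕ) : ℝ) := by
    rcases Nat.eq_zero_or_pos m with rfl | hm
    · simp
    · exact Real.log_le_log (by exact_mod_cast hm) (by push_cast; linarith)
  have h5 : Real.log ((m + 1 : ℕ) : ℝ) ≤ m := by
    have := Real.log_le_sub_one_of_pos (x := ((m + 1 : ℕ) : ℝ)) (by positivity)
    push_cast at this ⊢
    linarith
  have h6 : 0 ≤ Real.log ((m + 1 : ℕ) : ℝ) := Real.log_natCast_nonneg _
  push_cast at h2 h4 h5 h6 ⊢
  have hm : (0 : ℝ) ≤ m := Nat.cast_nonneg m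
  rw [abs_le]
  constructor <;> nlinarith

/-! ### Crossings of the walk and the expectation -/

section Walk

variable {Ω : Type*} [MeasurableSpace Ω] {P : Measure Ω} [IsProbabilityMeasure P] {n : ℕ}
  {X : Fin (n + 1) → Ω → Plane}

/-- The events may differ only when the two steps are parallel, which has probability zero. -/
theorem IsEquilateralIsotropicWalk.segmentsCross_ae_eq (hX : IsEquilateralIsotropicWalk X P)
    {k l : Fin n} (hkl : k < l) :
    {ω | SegmentsCross (fun i => X i ω) k l} =ᵐ[P]
      {ω | ∑ i ∈ Finset.Ioo k l, (X i.succ ω - X i.castSucc ω) ∈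
        crossingSet (X k.succ ω - X k.castSucc ω) (X l.succ ω - X l.castSucc ω)} := by
  have hind := hX.indep_steps.indepFun hkl.ne
  have hmap := (indepFun_iff_map_prod_eq_prod_map_map (hX.law_step k).aemeasurable
    (hX.law_step l).aemeasurable).1 hind
  rw [(hX.law_step k).map_eq, (hX.law_step l).map_eq] at hmap
  have hae := ae_planeDet_ne_zero
  rw [← hmap] at hae
  have hae' := ae_of_ae_map
    ((hX.law_step k).aemeasurable.prodMk (hX.law_step l).aemeasurable) hae
  filter_upwards [hae'] with ω hω
  refine propext ?_
  change SegmentsCross (fun i => X i ω) k l ↔ _ ∈ crossingSet _ _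
  rw [sum_Ioo_sub_eq (fun i => X i ω) hkl]
  exact openSegment_inter_nonempty_iff hω

theorem IsEquilateralIsotropicWalk.nullMeasurableSet_segmentsCross
    (hX : IsEquilateralIsotropicWalk X P) {k l : Fin n} (hkl : k < l) :
    NullMeasurableSet {ω | SegmentsCross (fun i => X i ω) k l} P := by
  refine NullMeasurableSet.congr ?_ (hX.segmentsCross_ae_eq hkl).symm
  have hm : ∀ i, AEMeasurable (fun ω => X (Fin.succ i) ω - X (Fin.castSucc i) ω) P :=
    fun i => (hX.law_step i).aemeasurable
  exact (((hm k).prodMk (hm l)).prodMk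
    (Finset.aemeasurable_fun_sum (Finset.Ioo k l) fun i _ => hm i)).nullMeasurable
    measurableSet_crossingSet_prod

end Walk

theorem mainTheorem1 :
    ∃ C : ℝ, ∀ (n : ℕ), 1 ≤ n →
      ∀ (Ω : Type*) [MeasurableSpace Ω] (P : Measure Ω) [IsProbabilityMeasure P]
        (X : Fin (n + 1) → Ω → Plane), IsEquilateralIsotropicWalk X P →
        Integrable (fun ω => (selfIntersections (fun k => X k ω) : ℝ)) P ∧
        |(∫ ω, (selfIntersections (fun k => X k ω) : ℝ) ∂P)
            - 2 / Real.pi ^ 2 * ((n : ℝ) * Real.log (n : ℝ))| ≤ C * (n : ℝ) := by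
  obtain ⟨e, hes, he0, he⟩ := exists_summable_abs_measureReal_sub_le
  have hpi := Real.pi_gt_three
  -- The first summand bounds the local limit errors for each l; the second comes from the error 2n
  -- in the harmonic sum.
  refine ⟨(∑' j, e j) + 2 / Real.pi ^ 2 * 2, fun n hn Ω _ P _ X hX => ?_⟩
  have hlt : ∀ p ∈ distantPairs n, p.1 < p.2 := fun p hp => by
    have := (Finset.mem_filter.1 hp).2
    exact Fin.lt_def.2 (by omega)
  have hcard : ∀ p ∈ distantPairs n, (Finset.Ioo p.1 p.2).card = p.2 - p.1 - 1 := fun p _ =>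
    Fin.card_Ioo _ _
  have hint : ∀ p ∈ distantPairs n,
      Integrable ({ω | SegmentsCross (fun k => X k ω) p.1 p.2}.indicator fun _ => (1 : ℝ)) P :=
    fun p hp => (integrable_const _).indicator₀ (hX.nullMeasurableSet_segmentsCross (hlt p hp))
  simp_rw [selfIntersections_eq_sum]
  refine ⟨integrable_finsetSum _ hint, ?_⟩
  rw [integral_finsetSum _ hint]
  have hterm : ∀ p ∈ distantPairs n,
      |∫ ω, {ω | SegmentsCross (fun k => X k ω) p.1 p.2}.indicator (fun _ => (1 : ℝ)) ω ∂P -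
        2 / Real.pi ^ 2 * (1 / ((p.2 - p.1 - 1 : ℕ) : ℝ))| ≤ e (p.2 - p.1 - 1) := by
    intro p hp
    have hs : (Finset.Ioo p.1 p.2).Nonempty := by
      rw [← Finset.card_pos, hcard p hp]
      have := (Finset.mem_filter.1 hp).2
      omega
    have h := abs_measureReal_sum_mem_crossingSet_sub_le he hX.indep_steps hX.law_step hs
      (hlt p hp).ne (by simp) (by simp)
    rw [hcard p hp, ← measureReal_congr (hX.segmentsCross_ae_eq (hlt p hp))] at h
    rw [integral_indicator₀ (hX.nullMeasurableSet_segmentsCross (hlt p hp))]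
    simpa using h
  have hsum1 : |∑ p ∈ distantPairs n,
      ∫ ω, {ω | SegmentsCross (fun k => X k ω) p.1 p.2}.indicator (fun _ => (1 : ℝ)) ω ∂P -
        2 / Real.pi ^ 2 * ∑ p ∈ distantPairs n, 1 / ((p.2 - p.1 - 1 : ℕ) : ℝ)| ≤
      (∑' j, e j) * n := by
    rw [Finset.mul_sum, ← Finset.sum_sub_distrib]
    refine (Finset.abs_sum_le_sum_abs _ _).trans ((Finset.sum_le_sum hterm).trans ?_)
    rw [sum_distantPairs]
    have hinner : ∀ l ∈ Finset.range n, ∑ j ∈ Finset.range (l - 1), e (j + 1) ≤ ∑' j, e j := by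
      intro l _
      have h := hes.sum_le_tsum (Finset.range (l - 1 + 1)) fun j _ => he0 j
      rw [Finset.sum_range_succ'] at h
      linarith [he0 0]
    refine (Finset.sum_le_sum hinner).trans (le_of_eq ?_)
    rw [Finset.sum_const, Finset.card_range, nsmul_eq_mul, mul_comm]
  have hsum2 := abs_sum_sum_inv_sub_le hn
  rw [← sum_distantPairs n fun j => 1 / (j : ℝ)] at hsum2
  have hsum3 := mul_le_mul_of_nonneg_left hsum2 (by positivity : 0 ≤ 2 / Real.pi ^ 2)
  rw [← abs_of_nonneg (by positivity : 0 ≤ 2 / Real.pi ^ 2), ← abs_mul,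
    abs_of_nonneg (by positivity : 0 ≤ 2 / Real.pi ^ 2), mul_sub] at hsum3
  refine (abs_sub_le _ _ _).trans ((add_le_add hsum1 hsum3).trans (le_of_eq ?_))
  ring
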